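/- **Setting.** Let $n\ge 1$, $p$ and $L\ge 2$ be integers. A random pair $(X,Y)$ has a label $Y\in\{e_1,\dots,e_L\}$ (the canonical basis of $\mathbb R^L$) with $\pi_\ell=\mathbb P\{Y=e_\ell\}>0$, and a feature $X\in\mathbb R^p$ with $X\mid Y=e_\ell\sim\mathcal N_p(\mu_\ell,\Sigma_W)$ for every $\ell$, where $\Sigma_W$ is positive definite, and $\mathbb E X=0$. Put $B=[\mathrm{Cov}(X)]^{-1}\mathrm{Cov}(X,Y)\in\mathbb R^{p\times L}$ and $r=\mathrm{rank}(B)$. Let $(X_1,Y_1),\dots,(X_n,Y_n)$ be i.i.d. copies of $(X,Y)$, and let $\mathbf X\in\mathbb R^{n\times p}$ and $\mathbf Y\in\{0,1\}^{n\times L}$ be the matrices with rows $X_i^\top$ and $Y_i^\top$. For $\lambda>0$ let $\widehat B$ be any global minimizer over $A\in\mathbb R^{p\times L}$ of $$\frac1n\|\mathbf Y-\mathbf X A\|_F^2+\lambda\,\mathrm{rank}(A).$$ **Assumptions.** For fixed constants $0<c_\pi\le C_\pi<\infty$, $0<c_\Delta\le C_\Delta<\infty$, $0<c_W\le C_W<\infty$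 and some $\Delta>0$: 1. $c_\pi/L\le\pi_\ell\le C_\pi/L$ for all $\ell$; 2. $c_\Delta\Delta\le(\mu_k-\mu_\ell)^\top\Sigma_W^{-1}(\mu_k-\mu_\ell)\le C_\Delta\Delta$ for all $k\ne\ell$; 3. the smallest eigenvalue of $\Sigma_W$ exceeds $c_W$, and $\max_{i,j}|[\Sigma_W]_{ij}|\le C_W$. **Theorem 8.** There exist constants $c,C,K_1,K_2>0$, depending only on $c_\pi,C_\pi,c_\Delta,C_\Delta,c_W,C_W$, such that in the above setting, if $$(p+L)\log n\le c\,n\qquad\text{and}\qquad \lambda\ge C\sqrt{\|\Sigma_W\|_{\rm op}(1+\Delta)}\,\sqrt{\frac{(p+L)\log n}{nL}},$$ then, with probability at least $1-2n^{-1}$, $$\max\Bigl\{n^{-1/2}\|\mathbf X(\widehat B-B)\|_F,\ \|\Sigma_W^{1/2}(\widehat B-B)\|_F\Bigr\}\le\omega_2,\qquad \sum_{j=1}^p\|(\widehat B-B)_{j\cdot}\|_2\le\omega_1,$$ where $\omega_2=K_2\sqrt{\lambda r}$ and $\omega_1=K_1\sqrt{\lambda r p}$. -/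

import Mathlib

open MeasureTheory ProbabilityTheory

namespace LDARegression

noncomputable section

/-- The Frobenius norm `‖Q‖_F`. -/
def frobNorm {m n : ℕ} (Q : Matrix (Fin m) (Fin n) ℝ) : ℝ :=
  √(∑ i, ∑ j, Q i j ^ 2)

/-- The norm `‖Q‖_{1,2}`: the sum of the Euclidean norms of the rows. -/
def rowNorm {m n : ℕ} (Q : Matrix (Fin m) (Fin n) ℝ) : ℝ :=
  ∑ i, √(∑ j, Q i j ^ 2)

/-- The operator norm `‖Q‖_op` of a square matrix acting on Euclidean space. -/
def opNorm {p : ℕ} (Q : Matrix (Fin p) (Fin p) ℝ) : ℝ :=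
  ‖Matrix.toEuclideanCLM (𝕜 := ℝ) Q‖

open scoped MatrixOrder in
/-- The positive semidefinite square root `S^{1/2}`. -/
def sqrtMat {p : ℕ} (S : Matrix (Fin p) (Fin p) ℝ) : Matrix (Fin p) (Fin p) ℝ :=
  CFC.sqrt S

/-- The space of a feature and its label; the label `ℓ` stands for the basis vector `e_ℓ`. -/
abbrev Obs (p L : ℕ) : Type := EuclideanSpace ℝ (Fin p) × Fin L

/-- The coordinate `Y_ℓ` of the one-hot encoding of the label. -/
def oneHot {L : ℕ} (y ℓ : Fin L) : ℝ := if y = ℓ then 1 else 0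

/-- `ν` is the joint law of a pair `(X, Y)` with class probabilities `prior`, with
`X | Y = e_ℓ ∼ N_p(μ_ℓ, S)` for a positive definite `S`, and with `E X = 0`. -/
structure IsLDALaw {p L : ℕ} (ν : Measure (Obs p L)) (prior : Fin L → ℝ)
    (μ : Fin L → EuclideanSpace ℝ (Fin p)) (S : Matrix (Fin p) (Fin p) ℝ) : Prop where
  isProbabilityMeasure : IsProbabilityMeasure ν
  prior_pos : ∀ ℓ, 0 < prior ℓ
  prob_label : ∀ ℓ, ν.real (Prod.snd ⁻¹' {ℓ}) = prior ℓ
  posDef : S.PosDef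
  cond_feature : ∀ ℓ, (cond ν (Prod.snd ⁻¹' {ℓ})).map Prod.fst = multivariateGaussian (μ ℓ) S
  centered : ∫ z, z.1 ∂ν = 0

/-- The unconditional covariance matrix `Σ = Cov(X)`. -/
def covX {p L : ℕ} (ν : Measure (Obs p L)) : Matrix (Fin p) (Fin p) ℝ :=
  Matrix.of fun i j => covariance (fun z : Obs p L => z.1 i) (fun z : Obs p L => z.1 j) ν

/-- The cross-covariance matrix `Cov(X, Y)`. -/
def covXY {p L : ℕ} (ν : Measure (Obs p L)) : Matrix (Fin p) (Fin L) ℝ :=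
  Matrix.of fun i ℓ =>
    covariance (fun z : Obs p L => z.1 i) (fun z : Obs p L => oneHot z.2 ℓ) ν

/-- The regression matrix `B = Cov(X)⁻¹ Cov(X, Y)`. -/
def regMatrix {p L : ℕ} (ν : Measure (Obs p L)) : Matrix (Fin p) (Fin L) ℝ :=
  (covX ν)⁻¹ * covXY ν

/-- The class probabilities are all of order `1 / L`. -/
def BalancedPriors {L : ℕ} (c C : ℝ) (prior : Fin L → ℝ) : Prop :=
  ∀ ℓ, c / L ≤ prior ℓ ∧ prior ℓ ≤ C / L

/-- The pairwise squared Mahalanobis distances of the class means are all of order `Δ`. -/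
def SeparatedMeans {p L : ℕ} (c C Δ : ℝ) (μ : Fin L → EuclideanSpace ℝ (Fin p))
    (S : Matrix (Fin p) (Fin p) ℝ) : Prop :=
  ∀ k ℓ, k ≠ ℓ →
    c * Δ ≤ (μ k - μ ℓ).ofLp ⬝ᵥ S⁻¹.mulVec (μ k - μ ℓ).ofLp ∧
      (μ k - μ ℓ).ofLp ⬝ᵥ S⁻¹.mulVec (μ k - μ ℓ).ofLp ≤ C * Δ

/-- The eigenvalues of `S` exceed `c` and its entries are at most `C` in absolute value. -/
def BoundedWithinCov {p : ℕ} (c C : ℝ) (S : Matrix (Fin p) (Fin p) ℝ) : Prop :=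
  (∃ hS : S.IsHermitian, ∀ j, c < hS.eigenvalues j) ∧ ∀ i j, |S i j| ≤ C

/-- The `n × p` feature matrix of a sample. -/
def featureMatrix {n p L : ℕ} (d : Fin n → Obs p L) : Matrix (Fin n) (Fin p) ℝ :=
  Matrix.of fun i j => (d i).1 j

/-- The `n × L` response matrix of a sample. -/
def responseMatrix {n p L : ℕ} (d : Fin n → Obs p L) : Matrix (Fin n) (Fin L) ℝ :=
  Matrix.of fun i ℓ => oneHot (d i).2 ℓ

/-- The rank-penalized least squares criterion `(1/n)‖Y - X A‖_F² + lam · rank(A)`. -/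
def rankCriterion {n p L : ℕ} (lam : ℝ) (d : Fin n → Obs p L)
    (A : Matrix (Fin p) (Fin L) ℝ) : ℝ :=
  1 / (n : ℝ) * frobNorm (responseMatrix d - featureMatrix d * A) ^ 2 + lam * (A.rank : ℝ)

/-- `A` is a reduced-rank regression estimate: a global minimizer of the criterion. -/
def IsRankEstimate {n p L : ℕ} (lam : ℝ) (d : Fin n → Obs p L)
    (A : Matrix (Fin p) (Fin L) ℝ) : Prop :=
  ∀ A' : Matrix (Fin p) (Fin L) ℝ, rankCriterion lam d A ≤ rankCriterion lam d A'

/-- The inequalities of the generic error condition, for an estimate `A` of `B`. -/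
def ErrorBounds {n p L : ℕ} (d : Fin n → Obs p L) (S : Matrix (Fin p) (Fin p) ℝ)
    (A B : Matrix (Fin p) (Fin L) ℝ) (ω₁ ω₂ : ℝ) : Prop :=
  max (frobNorm (featureMatrix d * (A - B)) / √(n : ℝ)) (frobNorm (sqrtMat S * (A - B))) ≤ ω₂ ∧
    rowNorm (A - B) ≤ ω₁

end

end LDARegression

/-!
The label, rescaled by the prior probabilities, and the whitened noise of an observation together
form an isotropic vector `ζ`. The features and the residuals of the population regression are inner
products with `ζ`, and the residuals are orthogonal to the features. Hence a single bound on the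
operator norm of `∑ᵢ ζᵢ ζᵢᵀ - n` does two things: it makes the empirical and population prediction
norms comparable, and it bounds the correlation between residuals and features. The bound holds with
high probability by a net argument, since given balanced labels the noise part of `ζ` is Gaussian.

The rank enters through the basic inequality for the penalised minimiser: expanding the residual
term in an eigenbasis of the Gram matrix of the fitted error, only as many terms contribute as the
rank of the error, and by Cauchy–Schwarz they are absorbed by the penalty.
-/

namespace LDARegression

section Net

variable {E G : Type*} [NormedAddCommGroup E] [NormedSpace ℝ E] [NormedAddCommGroup G]
  [NormedSpace ℝ G]

open Metric in
lemma packingNumber_closedBall_le [FiniteDimensional ℝ E] :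
    packingNumber (1 / 2) (closedBall (0 : E) 1) ≤ (5 ^ Module.finrank ℝ E : ℕ) := by
  classical
  refine iSup₂_le fun C hC => iSup_le fun hsep => ?_
  by_contra! hcard
  obtain ⟨t, htC, ht⟩ := Set.exists_subset_encard_eq (Order.add_one_le_of_lt hcard)
  obtain ⟨t, rfl⟩ := (Set.finite_of_encard_eq_coe
    (k := 5 ^ Module.finrank ℝ E + 1) ht).exists_finset_coe
  have hinj : Function.Injective fun x : E => (2 : ℝ) • x := smul_right_injective E two_ne_zero
  have hle : (t.image fun x => (2 : ℝ) • x).card ≤ 5 ^ Module.finrank ℝ E := by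
    refine Besicovitch.card_le_of_separated _ (Finset.forall_mem_image.2 fun x hx => ?_) ?_
    · have := mem_closedBall_zero_iff.1 (hC (htC hx))
      rw [norm_smul, Real.norm_two]
      linarith
    · simp only [Finset.forall_mem_image]
      intro x hx y hy hxy
      have hdist : ((1 / 2 : NNReal) : ENNReal) < edist x y :=
        hsep (htC hx) (htC hy) (ne_of_apply_ne _ hxy)
      rw [edist_nndist, ENNReal.coe_lt_coe, ← NNReal.coe_lt_coe, coe_nndist, dist_eq_norm] at hdist
      rw [← smul_sub, norm_smul, Real.norm_two]
      norm_num at hdist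
      linarith
  rw [Finset.card_image_of_injective _ hinj] at hle
  rw [Set.encard_coe_eq_coe_finsetCard] at ht
  norm_cast at ht
  omega

lemma exists_half_net (E : Type*) [NormedAddCommGroup E] [NormedSpace ℝ E]
    [FiniteDimensional ℝ E] :
    ∃ N : Finset E, N.card ≤ 5 ^ Module.finrank ℝ E ∧ (∀ y ∈ N, ‖y‖ ≤ 1) ∧
      ∀ x : E, ‖x‖ ≤ 1 → ∃ y ∈ N, ‖x - y‖ ≤ 1 / 2 := by
  have hle := (Metric.coveringNumber_le_packingNumber _ _).trans
    (packingNumber_closedBall_le (E := E))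
  obtain ⟨C, hC, hfin, hcov, hcard⟩ := Metric.exists_set_encard_eq_coveringNumber
    (hle.trans_lt (ENat.natCast_lt_top _)).ne
  obtain ⟨N, rfl⟩ := hfin.exists_finset_coe
  rw [Set.encard_coe_eq_coe_finsetCard] at hcard
  refine ⟨N, by exact_mod_cast hcard.trans_le hle, fun y hy => mem_closedBall_zero_iff.1 (hC hy),
    fun x hx => ?_⟩
  obtain ⟨y, hy, hxy⟩ := hcov (mem_closedBall_zero_iff.2 hx)
  refine ⟨y, hy, ?_⟩
  rw [← dist_eq_norm, ← edist_le_ofReal (by norm_num)]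
  exact hxy.trans_eq (by simp)

lemma opNorm_le_of_half_net {N : Finset E}
    (hN : ∀ x : E, ‖x‖ ≤ 1 → ∃ y ∈ N, ‖x - y‖ ≤ 1 / 2) (f : E →L[ℝ] G) {s : ℝ}
    (h : ∀ y ∈ N, ‖f y‖ ≤ s) : ‖f‖ ≤ 2 * s := by
  have hball : ∀ x : E, ‖x‖ ≤ 1 → ‖f x‖ ≤ s + ‖f‖ / 2 := fun x hx => by
    obtain ⟨y, hy, hxy⟩ := hN x hx
    calc ‖f x‖ = ‖f y + f (x - y)‖ := by rw [← map_add, add_sub_cancel]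
      _ ≤ ‖f y‖ + ‖f (x - y)‖ := norm_add_le _ _
      _ ≤ s + ‖f‖ * (1 / 2) := add_le_add (h y hy) (f.le_opNorm_of_le hxy)
      _ = s + ‖f‖ / 2 := by ring
  have h0 : 0 ≤ s + ‖f‖ / 2 := (norm_nonneg _).trans (hball 0 (by simp))
  linarith [f.opNorm_le_of_unit_norm h0 fun x hx => hball x hx.le]

lemma opNorm_bilinear_le_of_half_net {N : Finset E}
    (hN : ∀ x : E, ‖x‖ ≤ 1 → ∃ y ∈ N, ‖x - y‖ ≤ 1 / 2) (Q : E →L[ℝ] E →L[ℝ] ℝ) {s : ℝ}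
    (h : ∀ y ∈ N, ∀ z ∈ N, |Q y z| ≤ s) : ‖Q‖ ≤ 4 * s := by
  linarith [opNorm_le_of_half_net hN Q fun y hy => opNorm_le_of_half_net hN (Q y) (h y hy)]

lemma abs_bilinear_le_of_midpoints {Q : E →L[ℝ] E →L[ℝ] ℝ} (hQ : ∀ y z, Q y z = Q z y)
    {s : ℝ} {y z : E}
    (hadd : |Q ((1 / 2 : ℝ) • (y + z)) ((1 / 2 : ℝ) • (y + z))| ≤ s)
    (hsub : |Q ((1 / 2 : ℝ) • (y - z)) ((1 / 2 : ℝ) • (y - z))| ≤ s) : |Q y z| ≤ 2 * s := by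
  have hpol : Q y z = Q ((1 / 2 : ℝ) • (y + z)) ((1 / 2 : ℝ) • (y + z)) -
      Q ((1 / 2 : ℝ) • (y - z)) ((1 / 2 : ℝ) • (y - z)) := by
    simp [hQ z y]
    ring
  rw [hpol]
  linarith [abs_sub (Q ((1 / 2 : ℝ) • (y + z)) ((1 / 2 : ℝ) • (y + z)))
      (Q ((1 / 2 : ℝ) • (y - z)) ((1 / 2 : ℝ) • (y - z)))]

lemma measureReal_lt_opNorm_le {Ω : Type*} [MeasurableSpace Ω] {P : Measure Ω}
    [IsProbabilityMeasure P] [FiniteDimensional ℝ E] {Q : Ω → E →L[ℝ] E →L[ℝ] ℝ}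
    (hQ : ∀ ω y z, Q ω y z = Q ω z y) {s δ : ℝ}
    (h : ∀ u : E, ‖u‖ ≤ 1 → P.real {ω | s < |Q ω u u|} ≤ δ) :
    P.real {ω | 8 * s < ‖Q ω‖} ≤ 25 ^ Module.finrank ℝ E * (2 * δ) := by
  classical
  obtain ⟨N, hcard, hN, hcov⟩ := exists_half_net E
  let bad (u : E) : Set Ω := {ω | s < |Q ω u u|}
  have hsub : {ω | 8 * s < ‖Q ω‖} ⊆ ⋃ a ∈ N ×ˢ N,
      (bad ((1 / 2 : ℝ) • (a.1 + a.2)) ∪ bad ((1 / 2 : ℝ) • (a.1 - a.2))) := by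
    intro ω hω
    by_contra hgood
    simp only [Set.mem_iUnion, Finset.mem_product, not_exists, Set.mem_union, not_or, bad,
      Set.mem_ofPred_eq, not_lt, Prod.forall, and_imp] at hgood
    have hle := opNorm_bilinear_le_of_half_net hcov (Q ω) fun y hy z hz =>
      abs_bilinear_le_of_midpoints (hQ ω) (hgood y z hy hz).1 (hgood y z hy hz).2
    rw [Set.mem_ofPred_eq] at hω
    linarith
  have hmid : ∀ y ∈ N, ∀ z ∈ N, ‖(1 / 2 : ℝ) • (y + z)‖ ≤ 1 ∧ ‖(1 / 2 : ℝ) • (y - z)‖ ≤ 1 := by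
    intro y hy z hz
    rw [norm_smul, norm_smul]
    norm_num
    constructor <;> linarith [norm_add_le y z, norm_sub_le y z, hN y hy, hN z hz]
  have hδ : 0 ≤ δ := measureReal_nonneg.trans (h 0 (by simp))
  calc P.real {ω | 8 * s < ‖Q ω‖}
      ≤ ∑ a ∈ N ×ˢ N, P.real (bad ((1 / 2 : ℝ) • (a.1 + a.2)) ∪ bad ((1 / 2 : ℝ) • (a.1 - a.2))) :=
        (measureReal_mono hsub (measure_ne_top _ _)).trans (measureReal_biUnion_finset_le _ _)
    _ ≤ ∑ _a ∈ N ×ˢ N, 2 * δ := by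
        refine Finset.sum_le_sum fun a ha => (measureReal_union_le _ _).trans ?_
        obtain ⟨h₁, h₂⟩ := hmid a.1 (Finset.mem_product.1 ha).1 a.2 (Finset.mem_product.1 ha).2
        linarith [h _ h₁, h _ h₂]
    _ = (N.card * N.card : ℕ) * (2 * δ) := by
        rw [Finset.sum_const, Finset.card_product, nsmul_eq_mul]
    _ ≤ (5 ^ Module.finrank ℝ E * 5 ^ Module.finrank ℝ E : ℕ) * (2 * δ) := by gcongr
    _ = 25 ^ Module.finrank ℝ E * (2 * δ) := by push_cast; rw [← mul_pow]; norm_num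

end Net

section SubexponentialMGF

variable {Ω : Type*} [MeasurableSpace Ω] {P : Measure Ω} {X Y : Ω → ℝ} {v v' b b' : ℝ}

/-- A random variable `X` with `E exp (θ X) ≤ exp (v θ²)` for all `|θ| ≤ b`. This is the analogue of
`ProbabilityTheory.HasSubgaussianMGF` for variables, such as the square of a Gaussian one, whose
moment generating function is finite only near the origin; the constant `v` plays the role of half
the variance proxy. -/
structure HasSubexponentialMGF (X : Ω → ℝ) (v b : ℝ) (P : Measure Ω) : Prop where
  integrable_exp_mul : ∀ θ, |θ| ≤ b → Integrable (fun ω => Real.exp (θ * X ω)) P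
  mgf_le : ∀ θ, |θ| ≤ b → mgf X P θ ≤ Real.exp (v * θ ^ 2)

namespace HasSubexponentialMGF

lemma mono (hX : HasSubexponentialMGF X v b P) (hv : v ≤ v') (hb : b' ≤ b) :
    HasSubexponentialMGF X v' b' P where
  integrable_exp_mul θ hθ := hX.integrable_exp_mul θ (hθ.trans hb)
  mgf_le θ hθ := (hX.mgf_le θ (hθ.trans hb)).trans (by gcongr)

lemma const_mul (hX : HasSubexponentialMGF X v b P) {c : ℝ} (hb : b' * |c| ≤ b) :
    HasSubexponentialMGF (fun ω => c * X ω) (v * c ^ 2) b' P := by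
  have habs : ∀ θ, |θ| ≤ b' → |c * θ| ≤ b := fun θ hθ => by
    rw [abs_mul, mul_comm]
    exact (mul_le_mul_of_nonneg_right hθ (abs_nonneg c)).trans hb
  constructor
  · intro θ hθ
    simpa only [← mul_assoc, mul_comm θ c] using hX.integrable_exp_mul _ (habs θ hθ)
  · intro θ hθ
    rw [mgf_const_mul]
    exact (hX.mgf_le _ (habs θ hθ)).trans_eq (by ring_nf)

/-- By convexity, `exp (x + y)` is at most the average of `exp (2 x)` and `exp (2 y)`; this costs
constants but allows dependent variables. -/
lemma add (hX : HasSubexponentialMGF X v b P) (hY : HasSubexponentialMGF Y v b P) :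
    HasSubexponentialMGF (X + Y) (4 * v) (b / 2) P := by
  have habs : ∀ θ, |θ| ≤ b / 2 → |2 * θ| ≤ b := fun θ hθ => by
    rw [abs_mul, abs_two]
    linarith
  have havg : ∀ θ ω, Real.exp (θ * (X + Y) ω) ≤
      1 / 2 * Real.exp (2 * θ * X ω) + 1 / 2 * Real.exp (2 * θ * Y ω) := fun θ ω => by
    have h := convexOn_exp.2 (Set.mem_univ (2 * θ * X ω)) (Set.mem_univ (2 * θ * Y ω))
      (by norm_num : (0 : ℝ) ≤ 1 / 2) (by norm_num : (0 : ℝ) ≤ 1 / 2) (by norm_num)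
    simp only [smul_eq_mul] at h
    refine le_trans (le_of_eq ?_) h
    congr 1
    simp only [Pi.add_apply]
    ring
  have hint : ∀ θ, |θ| ≤ b / 2 → Integrable (fun ω =>
      1 / 2 * Real.exp (2 * θ * X ω) + 1 / 2 * Real.exp (2 * θ * Y ω)) P := fun θ hθ =>
    ((hX.integrable_exp_mul _ (habs θ hθ)).const_mul _).add
      ((hY.integrable_exp_mul _ (habs θ hθ)).const_mul _)
  have hint' : ∀ θ, |θ| ≤ b / 2 → Integrable (fun ω => Real.exp (θ * (X + Y) ω)) P := by
    intro θ hθ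
    have hθb : |θ| ≤ b := by linarith [abs_nonneg θ]
    refine (hint θ hθ).mono' (aestronglyMeasurable_exp_mul_add
      (hX.integrable_exp_mul θ hθb).aestronglyMeasurable
      (hY.integrable_exp_mul θ hθb).aestronglyMeasurable) (.of_forall fun ω => ?_)
    rw [Real.norm_of_nonneg (Real.exp_pos _).le]
    exact havg θ ω
  refine ⟨hint', fun θ hθ => ?_⟩
  calc mgf (X + Y) P θ
      ≤ ∫ ω, (1 / 2 * Real.exp (2 * θ * X ω) + 1 / 2 * Real.exp (2 * θ * Y ω)) ∂P :=
        integral_mono (hint' θ hθ) (hint θ hθ) (havg θ)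
    _ = 1 / 2 * mgf X P (2 * θ) + 1 / 2 * mgf Y P (2 * θ) := by
        rw [integral_add ((hX.integrable_exp_mul _ (habs θ hθ)).const_mul _)
          ((hY.integrable_exp_mul _ (habs θ hθ)).const_mul _), integral_const_mul,
          integral_const_mul, mgf, mgf]
    _ ≤ Real.exp (4 * v * θ ^ 2) := by
        rw [show 4 * v * θ ^ 2 = v * (2 * θ) ^ 2 by ring]
        linarith [hX.mgf_le _ (habs θ hθ), hY.mgf_le _ (habs θ hθ)]

lemma congr_identDistrib {Ω' : Type*} [MeasurableSpace Ω'] {P' : Measure Ω'} {Y : Ω' → ℝ}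
    (hX : HasSubexponentialMGF X v b P) (hXY : IdentDistrib X Y P P') :
    HasSubexponentialMGF Y v b P' where
  integrable_exp_mul θ hθ :=
    (hXY.comp (u := fun x => Real.exp (θ * x)) (by fun_prop)).integrable_iff.1
      (hX.integrable_exp_mul θ hθ)
  mgf_le θ hθ := by
    rw [← mgf_congr_identDistrib hXY]
    exact hX.mgf_le θ hθ

lemma sum_of_iIndepFun [IsFiniteMeasure P] {ι : Type*} [Fintype ι] {X : ι → Ω → ℝ} {v : ι → ℝ}
    (hX : ∀ i, HasSubexponentialMGF (X i) (v i) b P) (hind : iIndepFun X P)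
    (hmeas : ∀ i, Measurable (X i)) :
    HasSubexponentialMGF (∑ i, X i) (∑ i, v i) b P where
  integrable_exp_mul θ hθ :=
    hind.integrable_exp_mul_sum hmeas fun i _ => (hX i).integrable_exp_mul θ hθ
  mgf_le θ hθ := by
    rw [hind.mgf_sum hmeas, Finset.sum_mul, Real.exp_sum]
    exact Finset.prod_le_prod (fun i _ => mgf_nonneg) fun i _ => (hX i).mgf_le θ hθ

lemma sum_pi {ι α : Type*} [Fintype ι] [MeasurableSpace α] {m : Measure α}
    [IsProbabilityMeasure m] {f : ι → α → ℝ} {v : ι → ℝ}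
    (hf : ∀ i, HasSubexponentialMGF (f i) (v i) b m) (hmeas : ∀ i, Measurable (f i)) :
    HasSubexponentialMGF (fun x : ι → α => ∑ i, f i (x i)) (∑ i, v i) b
      (Measure.pi fun _ => m) := by
  have hcoord (i : ι) : HasSubexponentialMGF (fun x : ι → α => f i (x i)) (v i) b
      (Measure.pi fun _ => m) :=
    have heval : IdentDistrib id (Function.eval i) m (Measure.pi fun _ : ι => m) :=
      HasLaw.id.identDistrib (measurePreserving_eval (fun _ : ι => m) i).hasLaw
    (hf i).congr_identDistrib (heval.comp (hmeas i))
  convert sum_of_iIndepFun hcoord (iIndepFun_pi fun i => (hmeas i).aemeasurable) fun i =>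
    (hmeas i).comp (measurable_pi_apply i)
  simp

lemma measureReal_le_abs_le [IsFiniteMeasure P] (hX : HasSubexponentialMGF X v b P) (s : ℝ)
    {θ : ℝ} (hθ : 0 ≤ θ) (hθb : θ ≤ b) :
    P.real {ω | s ≤ |X ω|} ≤ 2 * Real.exp (v * θ ^ 2 - θ * s) := by
  have habs : |θ| ≤ b := by rwa [abs_of_nonneg hθ]
  have habs' : |-θ| ≤ b := by rwa [abs_neg]
  have hupper : P.real {ω | s ≤ X ω} ≤ Real.exp (v * θ ^ 2 - θ * s) :=
    calc P.real {ω | s ≤ X ω} ≤ Real.exp (-θ * s) * mgf X P θ :=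
          measure_ge_le_exp_mul_mgf s hθ (hX.integrable_exp_mul θ habs)
      _ ≤ Real.exp (-θ * s) * Real.exp (v * θ ^ 2) := by gcongr; exact hX.mgf_le θ habs
      _ = Real.exp (v * θ ^ 2 - θ * s) := by rw [← Real.exp_add]; ring_nf
  have hlower : P.real {ω | X ω ≤ -s} ≤ Real.exp (v * θ ^ 2 - θ * s) :=
    calc P.real {ω | X ω ≤ -s} ≤ Real.exp (-(-θ) * -s) * mgf X P (-θ) :=
          measure_le_le_exp_mul_mgf (-s) (neg_nonpos.2 hθ) (hX.integrable_exp_mul _ habs')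
      _ ≤ Real.exp (-(-θ) * -s) * Real.exp (v * (-θ) ^ 2) := by gcongr; exact hX.mgf_le _ habs'
      _ = Real.exp (v * θ ^ 2 - θ * s) := by rw [← Real.exp_add]; ring_nf
  have hsub : {ω | s ≤ |X ω|} ⊆ {ω | s ≤ X ω} ∪ {ω | X ω ≤ -s} := fun ω (hω : s ≤ |X ω|) =>
    (le_abs'.1 hω).symm
  linarith [(measureReal_mono hsub (measure_ne_top P _)).trans (measureReal_union_le _ _)]

end HasSubexponentialMGF

end SubexponentialMGF

lemma hasSubexponentialMGF_indicator_sub {α : Type*} [MeasurableSpace α] {m : Measure α}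
    [IsProbabilityMeasure m] {A : Set α} (hA : MeasurableSet A) :
    HasSubexponentialMGF (fun a => A.indicator 1 a - m.real A) (m.real A) 1 m := by
  have hexp : ∀ θ a, Real.exp (θ * (A.indicator 1 a - m.real A)) =
      Real.exp (-(θ * m.real A)) * (1 + A.indicator (fun _ => Real.exp θ - 1) a) := by
    intro θ a
    by_cases h : a ∈ A
    · simp [h, ← Real.exp_add]; ring_nf
    · simp [h]
  have hint : ∀ θ, Integrable (A.indicator fun _ => Real.exp θ - 1) m :=
    fun θ => (integrable_const _).indicator hA
  refine ⟨fun θ _ => ?_, fun θ hθ => ?_⟩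
  · simp only [hexp]
    exact ((integrable_const _).add (hint θ)).const_mul _
  calc mgf (fun a => A.indicator 1 a - m.real A) m θ
      = Real.exp (-(θ * m.real A)) * (1 + m.real A * (Real.exp θ - 1)) := by
        simp only [mgf, hexp]
        rw [integral_const_mul, integral_add (integrable_const _) (hint θ),
          integral_indicator_const _ hA]
        simp
    _ ≤ Real.exp (-(θ * m.real A)) * (1 + m.real A * (θ + θ ^ 2)) := by
        gcongr
        linarith [(abs_le.1 (Real.abs_exp_sub_one_sub_id_le hθ)).2]
    _ ≤ Real.exp (-(θ * m.real A)) * Real.exp (m.real A * (θ + θ ^ 2)) := by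
        gcongr
        linarith [Real.add_one_le_exp (m.real A * (θ + θ ^ 2))]
    _ = Real.exp (m.real A * θ ^ 2) := by rw [← Real.exp_add]; ring_nf

section Gaussian

lemma hasSubexponentialMGF_id_gaussianReal (b : ℝ) :
    HasSubexponentialMGF id (1 / 2) b (gaussianReal 0 1) where
  integrable_exp_mul θ _ := integrable_exp_mul_gaussianReal θ
  mgf_le θ _ := by
    rw [mgf_id_gaussianReal]
    refine Real.exp_le_exp.2 (le_of_eq ?_)
    push_cast
    ring

lemma gaussianPDFReal_mul_exp_sq (a x : ℝ) :
    gaussianPDFReal 0 1 x * Real.exp (a * (x ^ 2 - 1)) =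
      (√(2 * Real.pi))⁻¹ * Real.exp (-a) * Real.exp (-(1 / 2 - a) * x ^ 2) := by
  simp only [gaussianPDFReal, NNReal.coe_one, mul_one, sub_zero]
  rw [mul_assoc, mul_assoc, ← Real.exp_add, ← Real.exp_add]
  ring_nf

lemma integrable_exp_sq_sub_one_gaussianReal {a : ℝ} (ha : a < 1 / 2) :
    Integrable (fun x => Real.exp (a * (x ^ 2 - 1))) (gaussianReal 0 1) := by
  rw [gaussianReal_of_var_ne_zero _ one_ne_zero,
    integrable_withDensity_iff_integrable_smul₀' (by fun_prop) (by simp [gaussianPDF])]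
  simp only [gaussianPDF, ENNReal.toReal_ofReal (gaussianPDFReal_nonneg _ _ _), smul_eq_mul,
    gaussianPDFReal_mul_exp_sq]
  exact (integrable_exp_neg_mul_sq (by linarith)).const_mul _

lemma mgf_sq_sub_one_gaussianReal {a : ℝ} (ha : a < 1 / 2) :
    mgf (fun x => x ^ 2 - 1) (gaussianReal 0 1) a = Real.exp (-a) * (√(1 - 2 * a))⁻¹ := by
  have hsqrt : √(Real.pi / (1 / 2 - a)) = √(2 * Real.pi) * (√(1 - 2 * a))⁻¹ := by
    rw [← Real.sqrt_inv, ← Real.sqrt_mul (by positivity)]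
    congr 1
    have : 1 - 2 * a ≠ 0 := by linarith
    field_simp
  rw [mgf, integral_gaussianReal_eq_integral_smul one_ne_zero]
  simp only [smul_eq_mul, gaussianPDFReal_mul_exp_sq]
  rw [integral_const_mul, integral_gaussian, hsqrt]
  have : √(2 * Real.pi) ≠ 0 := by positivity
  field_simp

lemma one_le_one_sub_mul_exp {x : ℝ} (hx : x ≤ 1 / 2) :
    1 ≤ (1 - x) * Real.exp (x + 2 * x ^ 2) :=
  calc 1 ≤ (1 - x) * (x + 2 * x ^ 2 + 1) := by
        nlinarith [mul_nonneg (sq_nonneg x) (by linarith : 0 ≤ 1 - 2 * x)]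
    _ ≤ (1 - x) * Real.exp (x + 2 * x ^ 2) := by
        gcongr
        · linarith
        · exact Real.add_one_le_exp _

lemma hasSubexponentialMGF_sq_sub_one_gaussianReal :
    HasSubexponentialMGF (fun x => x ^ 2 - 1) 4 (1 / 4) (gaussianReal 0 1) where
  integrable_exp_mul a ha :=
    integrable_exp_sq_sub_one_gaussianReal (by linarith [(abs_le.1 ha).2])
  mgf_le a ha := by
    have ha' : a ≤ 1 / 4 := (abs_le.1 ha).2
    have hpos : 0 < √(1 - 2 * a) := Real.sqrt_pos.2 (by linarith)
    rw [mgf_sq_sub_one_gaussianReal (by linarith), ← div_eq_mul_inv, div_le_iff₀ hpos]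
    have hsq : 1 ≤ (√(1 - 2 * a) * Real.exp (a + 4 * a ^ 2)) ^ 2 := by
      rw [mul_pow, Real.sq_sqrt (by linarith), ← Real.exp_nat_mul]
      refine (one_le_one_sub_mul_exp (x := 2 * a) (by linarith)).trans_eq ?_
      push_cast
      ring_nf
    calc Real.exp (-a)
        ≤ Real.exp (-a) * (√(1 - 2 * a) * Real.exp (a + 4 * a ^ 2)) :=
          le_mul_of_one_le_right (Real.exp_pos _).le
            ((one_le_sq_iff₀ (by positivity)).1 hsq)
      _ = Real.exp (4 * a ^ 2) * √(1 - 2 * a) := by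
          rw [mul_left_comm, ← Real.exp_add, mul_comm]
          ring_nf

variable {E : Type*} [NormedAddCommGroup E] [InnerProductSpace ℝ E] [FiniteDimensional ℝ E]
  [MeasurableSpace E] [BorelSpace E]

lemma identDistrib_mul_norm_inner_stdGaussian (h : E) :
    IdentDistrib (fun x => ‖h‖ * x) (inner ℝ h) (gaussianReal 0 1) (stdGaussian E) where
  aemeasurable_fst := by fun_prop
  aemeasurable_snd := by fun_prop
  map_eq := by
    have hmap := IsGaussian.map_eq_gaussianReal (μ := stdGaussian E) (innerSL ℝ h)
    rw [integral_strongDual_stdGaussian, variance_dual_stdGaussian, innerSL_apply_norm,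
      coe_innerSL_apply] at hmap
    rw [hmap, gaussianReal_map_const_mul]
    congr 1
    · simp
    · ext
      simp

lemma hasSubexponentialMGF_inner_stdGaussian (h : E) (b : ℝ) :
    HasSubexponentialMGF (inner ℝ h) (‖h‖ ^ 2 / 2) b (stdGaussian E) :=
  (((hasSubexponentialMGF_id_gaussianReal _).const_mul le_rfl).congr_identDistrib
    (identDistrib_mul_norm_inner_stdGaussian h)).mono (by ring_nf; rfl) le_rfl

lemma hasSubexponentialMGF_inner_sq_sub_stdGaussian {h : E} (hh : ‖h‖ ≤ 1) :
    HasSubexponentialMGF (fun g => inner ℝ h g ^ 2 - ‖h‖ ^ 2) 4 (1 / 4) (stdGaussian E) := by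
  have hsq := (hasSubexponentialMGF_sq_sub_one_gaussianReal.const_mul (b' := 1 / 4)
    (c := ‖h‖ ^ 2) (by rw [abs_of_nonneg (by positivity)]; nlinarith [norm_nonneg h])).mono
    (v' := 4) (by nlinarith [norm_nonneg h, pow_le_one₀ (n := 4) (norm_nonneg h) hh]) le_rfl
  refine hsq.congr_identDistrib ?_
  convert (identDistrib_mul_norm_inner_stdGaussian h).comp (u := fun x => x ^ 2 - ‖h‖ ^ 2)
    (by fun_prop) using 1
  · ext x
    simp only [Function.comp]
    ring
  · rfl

end Gaussian

section GramDefect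

variable {H : Type*} [NormedAddCommGroup H] [InnerProductSpace ℝ H] {n : ℕ}

/-- The bilinear form `(u, w) ↦ ∑ᵢ ⟪ζᵢ, u⟫ ⟪ζᵢ, w⟫ - n ⟪u, w⟫`, which measures how far the sample
`ζ` is from being isotropic. -/
noncomputable def gramDefect (ζ : Fin n → H) : H →L[ℝ] H →L[ℝ] ℝ :=
  ∑ i, (innerSL ℝ (ζ i)).smulRight (innerSL ℝ (ζ i)) -
    (n : ℝ) • (isBoundedBilinearMap_inner (𝕜 := ℝ)).toContinuousLinearMap

lemma gramDefect_apply (ζ : Fin n → H) (u w : H) :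
    gramDefect ζ u w = ∑ i, inner ℝ (ζ i) u * inner ℝ (ζ i) w - n * inner ℝ u w := by
  simp [gramDefect]

lemma gramDefect_comm (ζ : Fin n → H) (u w : H) : gramDefect ζ u w = gramDefect ζ w u := by
  simp only [gramDefect_apply, mul_comm, real_inner_comm]

lemma continuous_norm_gramDefect : Continuous fun ζ : Fin n → H => ‖gramDefect ζ‖ := by
  have hsq : Continuous fun v : H => (innerSL ℝ v).smulRight (innerSL ℝ v) := by
    change Continuous fun v : H =>
      ContinuousLinearMap.smulRightL ℝ H (H →L[ℝ] ℝ) (innerSL ℝ v) (innerSL ℝ v)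
    fun_prop
  have hdefect : Continuous (gramDefect : (Fin n → H) → H →L[ℝ] H →L[ℝ] ℝ) :=
    (continuous_finsetSum _ fun i _ => hsq.comp (continuous_apply i)).sub continuous_const
  exact (continuous_norm (E := H →L[ℝ] H →L[ℝ] ℝ)).comp hdefect

lemma abs_sum_inner_sq_sub_le {ζ : Fin n → H} {δ : ℝ} (hζ : ‖gramDefect ζ‖ ≤ δ) (u : H) :
    |∑ i, inner ℝ (ζ i) u ^ 2 - n * ‖u‖ ^ 2| ≤ δ * ‖u‖ ^ 2 := by
  have h := (gramDefect ζ).le_of_opNorm₂_le_of_le hζ (le_refl ‖u‖) (le_refl ‖u‖)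
  rw [gramDefect_apply, real_inner_self_eq_norm_sq, Real.norm_eq_abs] at h
  simpa only [sq, mul_assoc] using h

end GramDefect

section LabelCount

variable {Λ : Type*} {n : ℕ}

/-- The number of indices `i` with `yᵢ = ℓ`, as a real number. -/
noncomputable def labelCount (y : Fin n → Λ) (ℓ : Λ) : ℝ :=
  ∑ i, Set.indicator {ℓ} 1 (y i)

lemma sum_comp_eq_sum_labelCount_mul [Fintype Λ] (y : Fin n → Λ) (f : Λ → ℝ) :
    ∑ i, f (y i) = ∑ ℓ, labelCount y ℓ * f ℓ := by
  classical
  simp only [labelCount, Finset.sum_mul]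
  rw [Finset.sum_comm]
  simp [Set.indicator_apply]

lemma measureReal_le_abs_labelCount_sub_le [MeasurableSpace Λ] [MeasurableSingletonClass Λ]
    (κ : Measure Λ) [IsProbabilityMeasure κ] (ℓ : Λ) {t : ℝ} (ht0 : 0 ≤ t) (ht1 : t ≤ 1) :
    (Measure.pi fun _ : Fin n => κ).real
        {y | n * κ.real {ℓ} * t ≤ |labelCount y ℓ - n * κ.real {ℓ}|} ≤
      2 * Real.exp (-(n * κ.real {ℓ} * t ^ 2 / 4)) := by
  have hsum := HasSubexponentialMGF.sum_pi
    (fun _ : Fin n => hasSubexponentialMGF_indicator_sub (m := κ) (measurableSet_singleton ℓ))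
    fun _ => (measurable_one.indicator (measurableSet_singleton ℓ)).sub_const _
  have h := hsum.measureReal_le_abs_le (n * κ.real {ℓ} * t) (θ := t / 2) (by linarith)
    (by linarith)
  simp only [Finset.sum_sub_distrib, Finset.sum_const, Finset.card_univ, Fintype.card_fin,
    nsmul_eq_mul] at h
  refine h.trans_eq ?_
  congr 2
  ring

lemma measureReal_exists_lt_abs_labelCount_sub_le [Fintype Λ] [MeasurableSpace Λ]
    [MeasurableSingletonClass Λ] {κ : Measure Λ} [IsProbabilityMeasure κ] {m t : ℝ}
    (hκ : ∀ ℓ, m ≤ κ.real {ℓ}) (ht0 : 0 ≤ t) (ht1 : t ≤ 1) :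
    (Measure.pi fun _ : Fin n => κ).real
        {y | ∃ ℓ, n * κ.real {ℓ} * t < |labelCount y ℓ - n * κ.real {ℓ}|} ≤
      Fintype.card Λ * (2 * Real.exp (-(n * m * t ^ 2 / 4))) := by
  have hsub : {y : Fin n → Λ | ∃ ℓ, n * κ.real {ℓ} * t < |labelCount y ℓ - n * κ.real {ℓ}|} ⊆
      ⋃ ℓ, {y | n * κ.real {ℓ} * t ≤ |labelCount y ℓ - n * κ.real {ℓ}|} := by
    rintro y ⟨ℓ, hy⟩
    exact Set.mem_iUnion.2 ⟨ℓ, hy.le⟩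
  calc _ ≤ ∑ ℓ, (Measure.pi fun _ : Fin n => κ).real
          {y | n * κ.real {ℓ} * t ≤ |labelCount y ℓ - n * κ.real {ℓ}|} :=
        (measureReal_mono hsub (measure_ne_top _ _)).trans (measureReal_iUnion_fintype_le _)
    _ ≤ ∑ _ℓ : Λ, 2 * Real.exp (-(n * m * t ^ 2 / 4)) := by
        refine Finset.sum_le_sum fun ℓ _ => ?_
        refine (measureReal_le_abs_labelCount_sub_le κ ℓ ht0 ht1).trans ?_
        gcongr
        exact hκ ℓ
    _ = _ := by rw [Finset.sum_const, Finset.card_univ, nsmul_eq_mul]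

lemma abs_sum_div_sub_le [Fintype Λ] {y : Fin n → Λ} {prior : Λ → ℝ} {t : ℝ}
    (hprior : ∀ ℓ, 0 < prior ℓ)
    (hy : ∀ ℓ, |labelCount y ℓ - n * prior ℓ| ≤ n * prior ℓ * t) {f : Λ → ℝ} (hf : ∀ ℓ, 0 ≤ f ℓ) :
    |∑ i, f (y i) / prior (y i) - n * ∑ ℓ, f ℓ| ≤ n * t * ∑ ℓ, f ℓ := by
  have hsplit : ∑ i, f (y i) / prior (y i) - n * ∑ ℓ, f ℓ =
      ∑ ℓ, (labelCount y ℓ - n * prior ℓ) * (f ℓ / prior ℓ) := by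
    rw [sum_comp_eq_sum_labelCount_mul y fun ℓ => f ℓ / prior ℓ, Finset.mul_sum,
      ← Finset.sum_sub_distrib]
    refine Finset.sum_congr rfl fun ℓ _ => ?_
    have := (hprior ℓ).ne'
    field_simp
  rw [hsplit, Finset.mul_sum]
  refine (Finset.abs_sum_le_sum_abs _ _).trans (Finset.sum_le_sum fun ℓ _ => ?_)
  have hq : 0 ≤ f ℓ / prior ℓ := div_nonneg (hf ℓ) (hprior ℓ).le
  calc |(labelCount y ℓ - n * prior ℓ) * (f ℓ / prior ℓ)|
      = |labelCount y ℓ - n * prior ℓ| * (f ℓ / prior ℓ) := by rw [abs_mul, abs_of_nonneg hq]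
    _ ≤ n * prior ℓ * t * (f ℓ / prior ℓ) := mul_le_mul_of_nonneg_right (hy ℓ) hq
    _ = n * t * f ℓ := by
        have := (hprior ℓ).ne'
        field_simp

end LabelCount

lemma measureReal_prod_le_add {α β : Type*} [MeasurableSpace α] [MeasurableSpace β]
    {κ : Measure α} {γ : Measure β} [IsProbabilityMeasure κ] [IsProbabilityMeasure γ]
    {s : Set (α × β)} (hs : MeasurableSet s) {A : Set α} {ε : ℝ} (hε : 0 ≤ ε)
    (hsec : ∀ a ∉ A, γ.real (Prod.mk a ⁻¹' s) ≤ ε) : (κ.prod γ).real s ≤ κ.real A + ε := by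
  have hbound : ∀ a, γ (Prod.mk a ⁻¹' s) ≤ A.indicator 1 a + ENNReal.ofReal ε := fun a => by
    by_cases ha : a ∈ A
    · simpa [ha] using (prob_le_one (μ := γ)).trans le_self_add
    · simpa [ha] using (ENNReal.le_ofReal_iff_toReal_le (measure_ne_top _ _) hε).2 (hsec a ha)
  refine ENNReal.toReal_le_of_le_ofReal (by positivity) ?_
  calc (κ.prod γ) s = ∫⁻ a, γ (Prod.mk a ⁻¹' s) ∂κ := Measure.prod_apply hs
    _ ≤ ∫⁻ a, (A.indicator 1 a + ENNReal.ofReal ε) ∂κ := lintegral_mono hbound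
    _ ≤ κ A + ENNReal.ofReal ε := by
        rw [lintegral_add_right _ measurable_const, lintegral_const, measure_univ, mul_one]
        gcongr
        exact lintegral_indicator_one_le A
    _ = ENNReal.ofReal (κ.real A + ε) := by
        rw [ENNReal.ofReal_add measureReal_nonneg hε, ofReal_measureReal]

section IsotropicVec

variable {Λ E : Type*} [DecidableEq Λ] {prior : Λ → ℝ} {n : ℕ}

/-- A label `y`, rescaled by its probability, paired with the noise `g`. When `y` is drawn from
`prior` and `g` is an independent standard Gaussian vector, this is an isotropic random vector. -/
noncomputable def isotropicVec (prior : Λ → ℝ) (y : Λ) (g : E) :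
    WithLp 2 (EuclideanSpace ℝ Λ × E) :=
  WithLp.toLp 2 (EuclideanSpace.single y (√(prior y))⁻¹, g)

lemma measurable_isotropicVec [Countable Λ] [MeasurableSpace Λ] [MeasurableSingletonClass Λ]
    [MeasurableSpace E] (prior : Λ → ℝ) :
    Measurable fun yg : Λ × E => isotropicVec prior yg.1 yg.2 :=
  measurable_from_prod_countable_right fun y => by
    simp only [isotropicVec]
    fun_prop

variable [Fintype Λ] [NormedAddCommGroup E] [InnerProductSpace ℝ E]

lemma inner_isotropicVec (y : Λ) (g : E) (u : WithLp 2 (EuclideanSpace ℝ Λ × E)) :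
    inner ℝ (isotropicVec prior y g) u = u.fst y / √(prior y) + inner ℝ g u.snd := by
  simp [isotropicVec, WithLp.prod_inner_apply, EuclideanSpace.inner_single_left, div_eq_inv_mul]

lemma gramDefect_isotropicVec_self (hprior : ∀ ℓ, 0 < prior ℓ) (y : Fin n → Λ) (g : Fin n → E)
    (u : WithLp 2 (EuclideanSpace ℝ Λ × E)) :
    gramDefect (fun i => isotropicVec prior (y i) (g i)) u u =
      (∑ i, u.fst (y i) ^ 2 / prior (y i) - n * ‖u.fst‖ ^ 2) +
        ∑ i, (2 * (u.fst (y i) / √(prior (y i))) * inner ℝ u.snd (g i) +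
          (inner ℝ u.snd (g i) ^ 2 - ‖u.snd‖ ^ 2)) := by
  have hsum : n * ‖u.snd‖ ^ 2 = ∑ _i : Fin n, ‖u.snd‖ ^ 2 := by simp
  rw [gramDefect_apply, real_inner_self_eq_norm_sq, WithLp.prod_norm_sq_eq_of_L2, mul_add, hsum,
    sub_add_eq_sub_sub_swap, ← Finset.sum_sub_distrib, sub_add_eq_add_sub,
    ← Finset.sum_add_distrib]
  congr 1
  refine Finset.sum_congr rfl fun i _ => ?_
  have hdiv : u.fst (y i) ^ 2 / prior (y i) = (u.fst (y i) / √(prior (y i))) ^ 2 := by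
    rw [div_pow, Real.sq_sqrt (hprior _).le]
  rw [inner_isotropicVec, real_inner_comm, hdiv]
  ring

variable [FiniteDimensional ℝ E] [MeasurableSpace E] [BorelSpace E]

lemma measureReal_le_abs_sum_gaussian_le {h : E} (hh : ‖h‖ ≤ 1) {a : Fin n → ℝ}
    (ha : ∑ i, a i ^ 2 ≤ 2 * n) {t : ℝ} (ht0 : 0 ≤ t) (ht1 : t ≤ 1) :
    (Measure.pi fun _ : Fin n => stdGaussian E).real
        {g | n * t ≤ |∑ i, (2 * a i * inner ℝ h (g i) + (inner ℝ h (g i) ^ 2 - ‖h‖ ^ 2))|} ≤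
      2 * Real.exp (-(n * t ^ 2 / 128)) := by
  have hterm (i : Fin n) : HasSubexponentialMGF
      (fun g => 2 * a i * inner ℝ h g + (inner ℝ h g ^ 2 - ‖h‖ ^ 2)) (16 + 8 * a i ^ 2) (1 / 8)
      (stdGaussian E) := by
    have hlin := (hasSubexponentialMGF_inner_stdGaussian h (1 / 4 * |2 * a i|)).const_mul
      (b' := 1 / 4) le_rfl
    have hquad := hasSubexponentialMGF_inner_sq_sub_stdGaussian hh
    have hv : ‖h‖ ^ 2 / 2 * (2 * a i) ^ 2 ≤ 4 + 2 * a i ^ 2 := by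
      nlinarith [pow_le_one₀ (n := 2) (norm_nonneg h) hh, sq_nonneg (a i)]
    have hv' : (4 : ℝ) ≤ 4 + 2 * a i ^ 2 := by nlinarith [sq_nonneg (a i)]
    exact ((hlin.mono hv le_rfl).add (hquad.mono hv' le_rfl)).mono (by linarith) (by norm_num)
  have htotal : ∑ i, (16 + 8 * a i ^ 2) ≤ (32 * n : ℝ) := by
    rw [Finset.sum_add_distrib, ← Finset.mul_sum]
    simp only [Finset.sum_const, Finset.card_univ, Fintype.card_fin, nsmul_eq_mul]
    linarith
  have hsum := (HasSubexponentialMGF.sum_pi hterm fun i => by fun_prop).mono htotal le_rfl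
  refine (hsum.measureReal_le_abs_le (n * t) (θ := t / 64) (by linarith) (by linarith)).trans_eq ?_
  congr 2
  ring

lemma measureReal_lt_norm_gramDefect_isotropicVec_le (hprior : ∀ ℓ, 0 < prior ℓ) {y : Fin n → Λ}
    {t : ℝ} (ht0 : 0 ≤ t) (ht1 : t ≤ 1)
    (hy : ∀ ℓ, |labelCount y ℓ - n * prior ℓ| ≤ n * prior ℓ * t) :
    (Measure.pi fun _ : Fin n => stdGaussian E).real
        {g | 16 * (n * t) < ‖gramDefect fun i => isotropicVec prior (y i) (g i)‖} ≤
      4 * 25 ^ (Fintype.card Λ + Module.finrank ℝ E) * Real.exp (-(n * t ^ 2 / 128)) := by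
  have hunit (u : WithLp 2 (EuclideanSpace ℝ Λ × E)) (hu : ‖u‖ ≤ 1) :
      (Measure.pi fun _ : Fin n => stdGaussian E).real
        {g | 2 * (n * t) < |gramDefect (fun i => isotropicVec prior (y i) (g i)) u u|} ≤
      2 * Real.exp (-(n * t ^ 2 / 128)) := by
    have hnorm := WithLp.prod_norm_sq_eq_of_L2 u
    have hu2 : ‖u‖ ^ 2 ≤ 1 := pow_le_one₀ (norm_nonneg u) hu
    have hsnd : ‖u.snd‖ ≤ 1 := by
      rw [← sq_le_one_iff₀ (norm_nonneg _)]
      linarith [sq_nonneg ‖u.fst‖]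
    have hlabel : |∑ i, u.fst (y i) ^ 2 / prior (y i) - n * ‖u.fst‖ ^ 2| ≤ n * t := by
      have h := abs_sum_div_sub_le hprior hy fun ℓ => sq_nonneg (u.fst ℓ)
      rw [← EuclideanSpace.real_norm_sq_eq] at h
      refine h.trans (mul_le_of_le_one_right (by positivity) ?_)
      linarith [sq_nonneg ‖u.snd‖]
    have hweight : ∑ i, (u.fst (y i) / √(prior (y i))) ^ 2 ≤ 2 * n := by
      simp only [div_pow, Real.sq_sqrt (hprior _).le]
      nlinarith [n.cast_nonneg (α := ℝ), (abs_le.1 hlabel).2, sq_nonneg ‖u.snd‖]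
    refine (measureReal_mono (fun g hg => ?_) (measure_ne_top _ _)).trans
      (measureReal_le_abs_sum_gaussian_le hsnd hweight ht0 ht1)
    rw [Set.mem_ofPred_eq, gramDefect_isotropicVec_self hprior] at hg
    rw [Set.mem_ofPred_eq]
    linarith [hg.trans_le (abs_add_le _ _)]
  have hnet := measureReal_lt_opNorm_le (fun _ => gramDefect_comm _) hunit
  rw [(WithLp.linearEquiv 2 ℝ (EuclideanSpace ℝ Λ × E)).finrank_eq, Module.finrank_prod,
    finrank_euclideanSpace, ← mul_assoc 8 2 ((n : ℝ) * t), show (8 : ℝ) * 2 = 16 by norm_num]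
    at hnet
  exact hnet.trans_eq (by ring)

lemma measurableSet_lt_norm_gramDefect_isotropicVec [MeasurableSpace Λ]
    [MeasurableSingletonClass Λ] (r : ℝ) :
    MeasurableSet {yg : (Fin n → Λ) × (Fin n → E) |
      r < ‖gramDefect fun i => isotropicVec prior (yg.1 i) (yg.2 i)‖} := by
  have hζ : Measurable fun (yg : (Fin n → Λ) × (Fin n → E)) i =>
      isotropicVec prior (yg.1 i) (yg.2 i) :=
    measurable_pi_lambda _ fun i => (measurable_isotropicVec prior).comp
      (f := fun yg : (Fin n → Λ) × (Fin n → E) => (yg.1 i, yg.2 i)) (by fun_prop)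
  exact measurableSet_lt measurable_const (continuous_norm_gramDefect.measurable.comp hζ)

lemma measureReal_prod_lt_norm_gramDefect_isotropicVec_le [MeasurableSpace Λ]
    [MeasurableSingletonClass Λ] {κ : Measure Λ} [IsProbabilityMeasure κ]
    (hκ : ∀ ℓ, κ.real {ℓ} = prior ℓ) {m : ℝ} (hm : 0 < m) (hprior : ∀ ℓ, m ≤ prior ℓ) {t : ℝ}
    (ht0 : 0 ≤ t) (ht1 : t ≤ 1) :
    ((Measure.pi fun _ : Fin n => κ).prod (Measure.pi fun _ => stdGaussian E)).real
        {yg | 16 * (n * t) < ‖gramDefect fun i => isotropicVec prior (yg.1 i) (yg.2 i)‖} ≤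
      Fintype.card Λ * (2 * Real.exp (-(n * m * t ^ 2 / 4))) +
        4 * 25 ^ (Fintype.card Λ + Module.finrank ℝ E) * Real.exp (-(n * t ^ 2 / 128)) := by
  refine (measureReal_prod_le_add
    (measurableSet_lt_norm_gramDefect_isotropicVec _) (by positivity) fun y hy => ?_).trans
    (add_le_add_left (measureReal_exists_lt_abs_labelCount_sub_le
      (fun ℓ => (hprior ℓ).trans_eq (hκ ℓ).symm) ht0 ht1) _)
  refine measureReal_lt_norm_gramDefect_isotropicVec_le (fun ℓ => hm.trans_le (hprior ℓ)) ht0 ht1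
    fun ℓ => ?_
  simpa only [hκ, not_lt] using not_exists.1 hy ℓ

end IsotropicVec

section Isotropy

variable {Λ E : Type*} [NormedAddCommGroup E] [InnerProductSpace ℝ E] [FiniteDimensional ℝ E]
  [MeasurableSpace E] [BorelSpace E]

lemma integral_inner_stdGaussian (h : E) : ∫ g, inner ℝ g h ∂stdGaussian E = 0 := by
  simpa only [innerSL_apply_apply, real_inner_comm] using
    integral_strongDual_stdGaussian (innerSL ℝ h)

lemma integral_inner_mul_inner_stdGaussian (h k : E) :
    ∫ g, inner ℝ g h * inner ℝ g k ∂stdGaussian E = inner ℝ h k := by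
  have hcov := covarianceBilin_apply (μ := stdGaussian E) IsGaussian.memLp_two_id h k
  simp only [covarianceBilin_stdGaussian, id_eq, integral_id_stdGaussian, sub_zero] at hcov
  rw [innerSL_apply_apply] at hcov
  simpa only [real_inner_comm] using hcov.symm

lemma memLp_inner_stdGaussian (h : E) : MemLp (fun g => inner ℝ g h) 2 (stdGaussian E) :=
  IsGaussian.memLp_two_id.inner_const h

variable [MeasurableSpace Λ] [MeasurableSingletonClass Λ] {κ : Measure Λ}
  [IsProbabilityMeasure κ]

lemma integral_add_inner_mul_add_inner [Finite Λ] (a b : Λ → ℝ) (h k : E) :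
    ∫ yg, (a yg.1 + inner ℝ yg.2 h) * (b yg.1 + inner ℝ yg.2 k) ∂κ.prod (stdGaussian E) =
      ∫ y, a y * b y ∂κ + inner ℝ h k := by
  have hcross (c : Λ → ℝ) (l : E) :
      Integrable (fun yg : Λ × E => c yg.1 * inner ℝ yg.2 l) (κ.prod (stdGaussian E)) ∧
        ∫ yg, c yg.1 * inner ℝ yg.2 l ∂κ.prod (stdGaussian E) = 0 :=
    ⟨Integrable.of_finite.mul_prod ((memLp_inner_stdGaussian l).integrable one_le_two), by
      rw [integral_prod_mul c fun g => inner ℝ g l, integral_inner_stdGaussian, mul_zero]⟩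
  have hlabel : Integrable (fun yg : Λ × E => a yg.1 * b yg.1) (κ.prod (stdGaussian E)) :=
    Integrable.of_finite.comp_fst (f := fun y => a y * b y) _
  have hgauss : Integrable (fun yg : Λ × E => inner ℝ yg.2 h * inner ℝ yg.2 k)
      (κ.prod (stdGaussian E)) :=
    ((memLp_inner_stdGaussian h).integrable_mul (memLp_inner_stdGaussian k)).comp_snd κ
  have hexpand (yg : Λ × E) : (a yg.1 + inner ℝ yg.2 h) * (b yg.1 + inner ℝ yg.2 k) =
      (a yg.1 * b yg.1 + inner ℝ yg.2 h * inner ℝ yg.2 k) +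
        (a yg.1 * inner ℝ yg.2 k + b yg.1 * inner ℝ yg.2 h) := by
    ring
  simp only [hexpand]
  rw [integral_add (by exact hlabel.add hgauss) (by exact (hcross a k).1.add (hcross b h).1),
    integral_add hlabel hgauss, integral_add (hcross a k).1 (hcross b h).1, (hcross a k).2,
    (hcross b h).2, integral_fun_fst fun y => a y * b y,
    integral_fun_snd fun g => inner ℝ g h * inner ℝ g k, integral_inner_mul_inner_stdGaussian]
  simp

variable [Fintype Λ] [DecidableEq Λ] {prior : Λ → ℝ}

lemma memLp_inner_isotropicVec (u : WithLp 2 (EuclideanSpace ℝ Λ × E)) :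
    MemLp (fun yg : Λ × E => inner ℝ (isotropicVec prior yg.1 yg.2) u) 2
      (κ.prod (stdGaussian E)) := by
  simp only [inner_isotropicVec]
  exact (MemLp.of_discrete.comp_fst (f := fun y => u.fst y / √(prior y)) _).add
    ((memLp_inner_stdGaussian u.snd).comp_snd _)

lemma integral_inner_mul_inner_isotropicVec (hκ : ∀ ℓ, κ.real {ℓ} = prior ℓ)
    (hprior : ∀ ℓ, 0 < prior ℓ) (u w : WithLp 2 (EuclideanSpace ℝ Λ × E)) :
    ∫ yg, inner ℝ (isotropicVec prior yg.1 yg.2) u * inner ℝ (isotropicVec prior yg.1 yg.2) w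
      ∂κ.prod (stdGaussian E) = inner ℝ u w := by
  simp only [inner_isotropicVec]
  rw [integral_add_inner_mul_add_inner (fun y => u.fst y / √(prior y))
    (fun y => w.fst y / √(prior y)), integral_fintype .of_finite, WithLp.prod_inner_apply,
    PiLp.inner_apply]
  congr 1
  refine Finset.sum_congr rfl fun ℓ _ => ?_
  rw [hκ, smul_eq_mul, div_mul_div_comm, Real.mul_self_sqrt (hprior ℓ).le,
    mul_div_cancel₀ _ (hprior ℓ).ne', mul_comm]
  rfl

end Isotropy

section ConditionalLaw

lemma map_snd_prodMk_eq_prod {Λ β δ : Type*} [Finite Λ] [MeasurableSpace Λ]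
    [MeasurableSingletonClass Λ] [MeasurableSpace β] [MeasurableSpace δ] {ν : Measure (β × Λ)}
    [IsFiniteMeasure ν] {γ : Measure δ} [SFinite γ] {f : Λ → β → δ} (hf : ∀ ℓ, Measurable (f ℓ))
    (hγ : ∀ ℓ, ((cond ν (Prod.snd ⁻¹' {ℓ})).map Prod.fst).map (f ℓ) = γ) :
    ν.map (fun z => (z.2, f z.2 z.1)) = (ν.map Prod.snd).prod γ := by
  have hmeas : Measurable fun z : β × Λ => (z.2, f z.2 z.1) :=
    measurable_snd.prodMk (measurable_from_prod_countable_left hf)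
  have := Fintype.ofFinite Λ
  ext s hs
  rw [Measure.map_apply hmeas hs, Measure.prod_apply hs, lintegral_fintype]
  conv_lhs => rw [← sum_meas_smul_cond_fiber measurable_snd ν]
  rw [Measure.finsetSum_apply]
  refine Finset.sum_congr rfl fun ℓ _ => ?_
  have hfib : MeasurableSet (Prod.snd ⁻¹' {ℓ} : Set (β × Λ)) :=
    measurable_snd (measurableSet_singleton ℓ)
  have hsec : cond ν (Prod.snd ⁻¹' {ℓ}) ((fun z : β × Λ => (z.2, f z.2 z.1)) ⁻¹' s) =
      γ (Prod.mk ℓ ⁻¹' s) := by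
    rw [← hγ ℓ, Measure.map_map (hf ℓ) measurable_fst, Measure.map_apply
      ((hf ℓ).comp measurable_fst) (measurable_prodMk_left hs)]
    refine measure_congr ?_
    filter_upwards [ae_cond_mem hfib] with z (hz : z.2 = ℓ)
    subst hz
    rfl
  rw [Measure.smul_apply, smul_eq_mul, hsec, Measure.map_apply measurable_snd
    (measurableSet_singleton ℓ), mul_comm]

end ConditionalLaw

noncomputable section

section Whitening

variable {p L : ℕ} {prior : Fin L → ℝ} {μ : Fin L → EuclideanSpace ℝ (Fin p)}
  {S : Matrix (Fin p) (Fin p) ℝ}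

/-- The operator on Euclidean space given by `S^{1/2}`. -/
def sqrtOp (S : Matrix (Fin p) (Fin p) ℝ) :
    EuclideanSpace ℝ (Fin p) →L[ℝ] EuclideanSpace ℝ (Fin p) :=
  Matrix.toEuclideanCLM (𝕜 := ℝ) (sqrtMat S)

open scoped MatrixOrder in
lemma inner_sqrtOp_left (S : Matrix (Fin p) (Fin p) ℝ) (x y : EuclideanSpace ℝ (Fin p)) :
    inner ℝ (sqrtOp S x) y = inner ℝ x (sqrtOp S y) := by
  have hsa : IsSelfAdjoint (sqrtOp S) := (CFC.sqrt_nonneg S).isSelfAdjoint.map _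
  rw [← ContinuousLinearMap.adjoint_inner_right, hsa.adjoint_eq]

open scoped MatrixOrder in
lemma norm_sqrtOp_sq (hS : S.PosSemidef) (x : EuclideanSpace ℝ (Fin p)) :
    ‖sqrtOp S x‖ ^ 2 = x.ofLp ⬝ᵥ S.mulVec x.ofLp := by
  rw [← real_inner_self_eq_norm_sq, inner_sqrtOp_left, ← mul_apply_eq_comp, sqrtOp,
    sqrtMat, ← map_mul, CFC.sqrt_mul_sqrt_self _ hS.nonneg, Matrix.inner_toEuclideanCLM]

lemma sqrtOp_injective (hS : S.PosDef) : Function.Injective (sqrtOp S) := by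
  refine (injective_iff_map_eq_zero _).2 fun x hx => ?_
  by_contra hx0
  have hpos := hS.dotProduct_mulVec_pos (x := x.ofLp) (by simpa using hx0)
  rw [star_trivial, ← norm_sqrtOp_sq hS.posSemidef, hx] at hpos
  simp at hpos

/-- The observation `z` with its class mean removed and rescaled by `S^{-1/2}`. -/
def whiteNoise (μ : Fin L → EuclideanSpace ℝ (Fin p)) (S : Matrix (Fin p) (Fin p) ℝ)
    (z : Obs p L) : EuclideanSpace ℝ (Fin p) :=
  Matrix.toEuclideanCLM (𝕜 := ℝ) (sqrtMat S)⁻¹ (z.1 - μ z.2)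

lemma measurable_whiteNoise : Measurable (whiteNoise μ S) := by
  have := measurable_of_countable μ
  unfold whiteNoise
  fun_prop

open scoped MatrixOrder in
lemma isUnit_det_sqrtMat (hS : S.PosDef) : IsUnit (sqrtMat S).det :=
  (Matrix.isUnit_iff_isUnit_det _).1 ((CFC.isUnit_sqrt_iff S hS.posSemidef.nonneg).2 hS.isUnit)

lemma sqrtOp_whiteNoise (hS : S.PosDef) (z : Obs p L) :
    sqrtOp S (whiteNoise μ S z) = z.1 - μ z.2 := by
  rw [sqrtOp, whiteNoise, ← mul_apply_eq_comp, ← map_mul,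
    Matrix.mul_nonsing_inv _ (isUnit_det_sqrtMat hS), map_one, one_apply_eq_self]

lemma toEuclideanCLM_inv_sqrtOp (hS : S.PosDef) (x : EuclideanSpace ℝ (Fin p)) :
    Matrix.toEuclideanCLM (𝕜 := ℝ) (sqrtMat S)⁻¹ (sqrtOp S x) = x := by
  rw [sqrtOp, ← mul_apply_eq_comp, ← map_mul,
    Matrix.nonsing_inv_mul _ (isUnit_det_sqrtMat hS), map_one, one_apply_eq_self]

lemma map_inv_sqrtOp_multivariateGaussian (hS : S.PosDef) (m : EuclideanSpace ℝ (Fin p)) :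
    (multivariateGaussian m S).map
        (fun x => Matrix.toEuclideanCLM (𝕜 := ℝ) (sqrtMat S)⁻¹ (x - m)) =
      stdGaussian (EuclideanSpace ℝ (Fin p)) := by
  change ((stdGaussian _).map fun g => m + sqrtOp S g).map _ = _
  rw [Measure.map_map (by fun_prop) (by fun_prop)]
  simp only [Function.comp_def, add_sub_cancel_left, toEuclideanCLM_inv_sqrtOp hS, Measure.map_id']

/-- The isotropic vector formed by the label and the whitened noise of an observation. -/
def whiten (prior : Fin L → ℝ) (μ : Fin L → EuclideanSpace ℝ (Fin p))
    (S : Matrix (Fin p) (Fin p) ℝ) (z : Obs p L) :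
    WithLp 2 (EuclideanSpace ℝ (Fin L) × EuclideanSpace ℝ (Fin p)) :=
  isotropicVec prior z.2 (whiteNoise μ S z)

/-- The linear map taking `e` to the vector whose inner product with the whitened observation is
`⟨X, e⟩`. -/
def featureMap (prior : Fin L → ℝ) (μ : Fin L → EuclideanSpace ℝ (Fin p))
    (S : Matrix (Fin p) (Fin p) ℝ) : EuclideanSpace ℝ (Fin p) →ₗ[ℝ]
      WithLp 2 (EuclideanSpace ℝ (Fin L) × EuclideanSpace ℝ (Fin p)) where
  toFun e := WithLp.toLp 2 (WithLp.toLp 2 fun ℓ => √(prior ℓ) * inner ℝ (μ ℓ) e, sqrtOp S e)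
  map_add' e e' := by
    refine WithLp.ofLp_injective 2 (Prod.ext (PiLp.ext fun ℓ => ?_) ?_) <;>
      simp [inner_add_right, mul_add]
  map_smul' a e := by
    refine WithLp.ofLp_injective 2 (Prod.ext (PiLp.ext fun ℓ => ?_) ?_) <;>
      simp [inner_smul_right, mul_left_comm]

/-- The linear map taking `v` to the vector whose inner product with the whitened observation is
the coordinate of `v` at the label. -/
def labelMap (prior : Fin L → ℝ) : EuclideanSpace ℝ (Fin L) →ₗ[ℝ]
      WithLp 2 (EuclideanSpace ℝ (Fin L) × EuclideanSpace ℝ (Fin p)) where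
  toFun v := WithLp.toLp 2 (WithLp.toLp 2 fun ℓ => √(prior ℓ) * v ℓ, 0)
  map_add' v v' := by
    refine WithLp.ofLp_injective 2 (Prod.ext (PiLp.ext fun ℓ => ?_) ?_) <;> simp [mul_add]
  map_smul' a v := by
    refine WithLp.ofLp_injective 2 (Prod.ext (PiLp.ext fun ℓ => ?_) ?_) <;> simp [mul_left_comm]

lemma inner_whiten_featureMap (hprior : ∀ ℓ, 0 < prior ℓ) (hS : S.PosDef) (z : Obs p L)
    (e : EuclideanSpace ℝ (Fin p)) :
    inner ℝ (whiten prior μ S z) (featureMap prior μ S e) = inner ℝ z.1 e := by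
  have hsqrt := (Real.sqrt_pos.2 (hprior z.2)).ne'
  calc inner ℝ (whiten prior μ S z) (featureMap prior μ S e)
      = √(prior z.2) * inner ℝ (μ z.2) e / √(prior z.2) +
          inner ℝ (whiteNoise μ S z) (sqrtOp S e) := inner_isotropicVec _ _ _
    _ = inner ℝ (μ z.2) e + inner ℝ (z.1 - μ z.2) e := by
        rw [mul_div_cancel_left₀ _ hsqrt, ← inner_sqrtOp_left, sqrtOp_whiteNoise hS]
    _ = inner ℝ z.1 e := by rw [← inner_add_left, add_sub_cancel]

lemma inner_whiten_labelMap (hprior : ∀ ℓ, 0 < prior ℓ) (z : Obs p L)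
    (v : EuclideanSpace ℝ (Fin L)) :
    inner ℝ (whiten prior μ S z) (labelMap prior v) = v z.2 := by
  have hsqrt := (Real.sqrt_pos.2 (hprior z.2)).ne'
  calc inner ℝ (whiten prior μ S z) (labelMap prior v)
      = √(prior z.2) * v z.2 / √(prior z.2) + inner ℝ (whiteNoise μ S z) 0 :=
        inner_isotropicVec _ _ _
    _ = v z.2 := by rw [mul_div_cancel_left₀ _ hsqrt, inner_zero_right, add_zero]

lemma norm_sqrtOp_le_norm_featureMap (e : EuclideanSpace ℝ (Fin p)) :
    ‖sqrtOp S e‖ ≤ ‖featureMap prior μ S e‖ :=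
  WithLp.norm_snd_le _ (featureMap prior μ S e)

lemma featureMap_injective (hS : S.PosDef) : Function.Injective (featureMap prior μ S) :=
  fun _ _ h => sqrtOp_injective hS (congrArg (·.snd) h)

lemma norm_labelMap_sq_le (hprior : ∀ ℓ, 0 ≤ prior ℓ) {M : ℝ} (hM : ∀ ℓ, prior ℓ ≤ M)
    (v : EuclideanSpace ℝ (Fin L)) : ‖labelMap (p := p) prior v‖ ^ 2 ≤ M * ‖v‖ ^ 2 := by
  calc ‖labelMap (p := p) prior v‖ ^ 2
      = ∑ ℓ, (√(prior ℓ) * v ℓ) ^ 2 + ‖(0 : EuclideanSpace ℝ (Fin p))‖ ^ 2 := by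
        rw [WithLp.prod_norm_sq_eq_of_L2, EuclideanSpace.real_norm_sq_eq (labelMap prior v).fst]
        rfl
    _ = ∑ ℓ, prior ℓ * v ℓ ^ 2 := by
        simp only [mul_pow, Real.sq_sqrt (hprior _), norm_zero, ne_eq, OfNat.ofNat_ne_zero,
          not_false_eq_true, zero_pow, add_zero]
    _ ≤ ∑ ℓ, M * v ℓ ^ 2 := by
        gcongr with ℓ
        exact hM ℓ
    _ = M * ‖v‖ ^ 2 := by rw [EuclideanSpace.real_norm_sq_eq, Finset.mul_sum]

/-- The residual `⟨v, Y - Bᵀ X⟩`, represented as the vector whose inner product with the whitened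
observation it is. -/
def residualVec (prior : Fin L → ℝ) (μ : Fin L → EuclideanSpace ℝ (Fin p))
    (S : Matrix (Fin p) (Fin p) ℝ) (B : Matrix (Fin p) (Fin L) ℝ) (v : EuclideanSpace ℝ (Fin L)) :
    WithLp 2 (EuclideanSpace ℝ (Fin L) × EuclideanSpace ℝ (Fin p)) :=
  labelMap prior v - featureMap prior μ S (WithLp.toLp 2 (B.mulVec v.ofLp))

end Whitening

lemma dotProduct_inner_mulVec {ι κ F : Type*} [Fintype ι] [DecidableEq ι] [Fintype κ]
    [DecidableEq κ] [NormedAddCommGroup F] [InnerProductSpace ℝ F]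
    (f : EuclideanSpace ℝ ι →ₗ[ℝ] F) (g : EuclideanSpace ℝ κ →ₗ[ℝ] F)
    (x : EuclideanSpace ℝ ι) (y : EuclideanSpace ℝ κ) :
    x.ofLp ⬝ᵥ (Matrix.of fun i j => inner ℝ (f (EuclideanSpace.single i 1))
      (g (EuclideanSpace.single j 1))).mulVec y.ofLp = inner ℝ (f x) (g y) := by
  conv_rhs =>
    rw [← (EuclideanSpace.basisFun ι ℝ).sum_repr x, ← (EuclideanSpace.basisFun κ ℝ).sum_repr y]
  simp only [EuclideanSpace.basisFun_repr, EuclideanSpace.basisFun_apply, map_sum, map_smul,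
    sum_inner, inner_sum, real_inner_smul_left, real_inner_smul_right, dotProduct, Matrix.mulVec,
    Matrix.of_apply, Finset.mul_sum]
  rw [Finset.sum_comm]
  refine Finset.sum_congr rfl fun j _ => Finset.sum_congr rfl fun i _ => ?_
  ring

namespace IsLDALaw

variable {p L : ℕ} {ν : Measure (Obs p L)} {prior : Fin L → ℝ}
  {μ : Fin L → EuclideanSpace ℝ (Fin p)} {S : Matrix (Fin p) (Fin p) ℝ}

lemma hasLaw_snd_whiteNoise (h : IsLDALaw ν prior μ S) :
    HasLaw (fun z => (z.2, whiteNoise μ S z))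
      ((ν.map Prod.snd).prod (stdGaussian (EuclideanSpace ℝ (Fin p)))) ν where
  aemeasurable := (measurable_snd.prodMk measurable_whiteNoise).aemeasurable
  map_eq := by
    have := h.isProbabilityMeasure
    refine map_snd_prodMk_eq_prod
      (f := fun ℓ x => Matrix.toEuclideanCLM (𝕜 := ℝ) (sqrtMat S)⁻¹ (x - μ ℓ))
      (fun ℓ => by fun_prop) fun ℓ => ?_
    rw [h.cond_feature, map_inv_sqrtOp_multivariateGaussian h.posDef]

lemma isProbabilityMeasure_map_snd (h : IsLDALaw ν prior μ S) :
    IsProbabilityMeasure (ν.map Prod.snd) :=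
  have := h.isProbabilityMeasure
  Measure.isProbabilityMeasure_map measurable_snd.aemeasurable

lemma real_map_snd_singleton (h : IsLDALaw ν prior μ S) (ℓ : Fin L) :
    (ν.map Prod.snd).real {ℓ} = prior ℓ := by
  rw [map_measureReal_apply measurable_snd (measurableSet_singleton ℓ), h.prob_label]

lemma memLp_inner_whiten (h : IsLDALaw ν prior μ S)
    (u : WithLp 2 (EuclideanSpace ℝ (Fin L) × EuclideanSpace ℝ (Fin p))) :
    MemLp (fun z => inner ℝ (whiten prior μ S z) u) 2 ν := by
  have := h.isProbabilityMeasure_map_snd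
  have hu := memLp_inner_isotropicVec (κ := ν.map Prod.snd) (prior := prior) u
  rw [← h.hasLaw_snd_whiteNoise.map_eq] at hu
  exact hu.comp_of_map h.hasLaw_snd_whiteNoise.aemeasurable

lemma integral_inner_whiten_mul_inner_whiten (h : IsLDALaw ν prior μ S)
    (u w : WithLp 2 (EuclideanSpace ℝ (Fin L) × EuclideanSpace ℝ (Fin p))) :
    ∫ z, inner ℝ (whiten prior μ S z) u * inner ℝ (whiten prior μ S z) w ∂ν = inner ℝ u w := by
  have := h.isProbabilityMeasure_map_snd
  have hmeas := measurable_isotropicVec (E := EuclideanSpace ℝ (Fin p)) prior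
  rw [← integral_inner_mul_inner_isotropicVec h.real_map_snd_singleton h.prior_pos u w,
    ← h.hasLaw_snd_whiteNoise.integral_comp]
  · rfl
  · exact Measurable.aestronglyMeasurable (by fun_prop)

lemma memLp_feature (h : IsLDALaw ν prior μ S) (i : Fin p) :
    MemLp (fun z : Obs p L => z.1 i) 2 ν := by
  simpa only [inner_whiten_featureMap h.prior_pos h.posDef, EuclideanSpace.inner_single_right,
    one_mul, conj_trivial] using
    h.memLp_inner_whiten (featureMap prior μ S (EuclideanSpace.single i 1))

lemma integral_feature (h : IsLDALaw ν prior μ S) (i : Fin p) : ∫ z, z.1 i ∂ν = 0 := by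
  have := h.isProbabilityMeasure
  rw [← eval_integral_piLp fun j => (h.memLp_feature j).integrable one_le_two, h.centered]
  rfl

lemma covariance_feature (h : IsLDALaw ν prior μ S) (i : Fin p)
    (u : WithLp 2 (EuclideanSpace ℝ (Fin L) × EuclideanSpace ℝ (Fin p))) :
    covariance (fun z : Obs p L => z.1 i) (fun z => inner ℝ (whiten prior μ S z) u) ν =
      inner ℝ (featureMap prior μ S (EuclideanSpace.single i 1)) u := by
  have := h.isProbabilityMeasure
  rw [covariance_eq_sub (h.memLp_feature i) (h.memLp_inner_whiten u), h.integral_feature,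
    zero_mul, sub_zero, ← h.integral_inner_whiten_mul_inner_whiten]
  simp [inner_whiten_featureMap h.prior_pos h.posDef, EuclideanSpace.inner_single_right]

lemma covX_eq_gram (h : IsLDALaw ν prior μ S) :
    covX ν = Matrix.gram ℝ fun i => featureMap prior μ S (EuclideanSpace.single i 1) := by
  ext i j
  rw [Matrix.gram_apply, ← h.covariance_feature]
  simp [covX, inner_whiten_featureMap h.prior_pos h.posDef, EuclideanSpace.inner_single_right]

lemma covXY_eq_of_inner (h : IsLDALaw ν prior μ S) :
    covXY ν = Matrix.of fun i ℓ => inner ℝ (featureMap prior μ S (EuclideanSpace.single i 1))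
      (labelMap prior (EuclideanSpace.single ℓ 1)) := by
  ext i ℓ
  rw [Matrix.of_apply, ← h.covariance_feature]
  simp [covXY, inner_whiten_labelMap h.prior_pos, oneHot]

lemma posDef_covX (h : IsLDALaw ν prior μ S) : (covX ν).PosDef := by
  rw [h.covX_eq_gram]
  refine Matrix.posDef_gram_of_linearIndependent ?_
  simpa only [Function.comp_def, EuclideanSpace.basisFun_apply] using
    (EuclideanSpace.basisFun (Fin p) ℝ).orthonormal.linearIndependent.map' _
      (LinearMap.ker_eq_bot.2 (featureMap_injective h.posDef))

lemma inner_featureMap_residual (h : IsLDALaw ν prior μ S) (e : EuclideanSpace ℝ (Fin p))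
    (v : EuclideanSpace ℝ (Fin L)) :
    inner ℝ (featureMap prior μ S e) (residualVec prior μ S (regMatrix ν) v) = 0 := by
  rw [residualVec, inner_sub_right, sub_eq_zero, ← dotProduct_inner_mulVec,
    ← dotProduct_inner_mulVec, ← h.covXY_eq_of_inner, regMatrix, WithLp.ofLp_toLp,
    Matrix.mulVec_mulVec, ← Matrix.gram, ← h.covX_eq_gram, ← Matrix.mul_assoc,
    Matrix.mul_nonsing_inv _ ((Matrix.isUnit_iff_isUnit_det _).1 h.posDef_covX.isUnit),
    Matrix.one_mul]

lemma norm_residualVec_sq_le (h : IsLDALaw ν prior μ S) {M : ℝ} (hM : ∀ ℓ, prior ℓ ≤ M)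
    (v : EuclideanSpace ℝ (Fin L)) :
    ‖residualVec prior μ S (regMatrix ν) v‖ ^ 2 ≤ M * ‖v‖ ^ 2 := by
  refine le_trans ?_ (norm_labelMap_sq_le (p := p) (fun ℓ => (h.prior_pos ℓ).le) hM v)
  have hfit := h.inner_featureMap_residual (WithLp.toLp 2 ((regMatrix ν).mulVec v.ofLp)) v
  have hpyth := norm_add_sq_real (featureMap prior μ S
    (WithLp.toLp 2 ((regMatrix ν).mulVec v.ofLp))) (residualVec prior μ S (regMatrix ν) v)
  rw [hfit, residualVec, add_sub_cancel, ← residualVec] at hpyth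
  nlinarith [sq_nonneg ‖featureMap prior μ S (WithLp.toLp 2 ((regMatrix ν).mulVec v.ofLp))‖]

end IsLDALaw

end

section SampleLaw

variable {n p L : ℕ} {ν : Measure (Obs p L)} {prior : Fin L → ℝ}
  {μ : Fin L → EuclideanSpace ℝ (Fin p)} {S : Matrix (Fin p) (Fin p) ℝ}
  {Ω : Type*} [MeasurableSpace Ω] {P : Measure Ω} {D : Fin n → Ω → Obs p L}

lemma IsLDALaw.hasLaw_labels_whiteNoise (h : IsLDALaw ν prior μ S) (hind : iIndepFun D P)
    (hD : ∀ i, HasLaw (D i) ν P) :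
    HasLaw (fun ω => (fun i => (D i ω).2, fun i => whiteNoise μ S (D i ω)))
      ((Measure.pi fun _ : Fin n => ν.map Prod.snd).prod
        (Measure.pi fun _ => stdGaussian (EuclideanSpace ℝ (Fin p)))) P := by
  have := h.isProbabilityMeasure_map_snd
  have hpair := iIndepFun.hasLaw_pi (fun i => h.hasLaw_snd_whiteNoise.comp (hD i))
    (hind.comp (fun _ z => (z.2, whiteNoise μ S z))
      fun _ => measurable_snd.prodMk measurable_whiteNoise)
  have hsplit := measurePreserving_arrowProdEquivProdArrow (Fin L) (EuclideanSpace ℝ (Fin p))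
    (Fin n) (fun _ => ν.map Prod.snd) (fun _ => stdGaussian _)
  exact HasLaw.comp ⟨hsplit.measurable.aemeasurable, hsplit.map_eq⟩ hpair

lemma IsLDALaw.measureReal_lt_norm_gramDefect_whiten_le (h : IsLDALaw ν prior μ S)
    (hind : iIndepFun D P) (hD : ∀ i, HasLaw (D i) ν P) {m : ℝ} (hm : 0 < m)
    (hprior : ∀ ℓ, m ≤ prior ℓ) {t : ℝ} (ht0 : 0 ≤ t) (ht1 : t ≤ 1) :
    P.real {ω | 16 * (n * t) < ‖gramDefect fun i => whiten prior μ S (D i ω)‖} ≤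
      L * (2 * Real.exp (-(n * m * t ^ 2 / 4))) +
        4 * 25 ^ (L + p) * Real.exp (-(n * t ^ 2 / 128)) := by
  have := h.isProbabilityMeasure_map_snd
  have hle := measureReal_prod_lt_norm_gramDefect_isotropicVec_le (n := n)
    (E := EuclideanSpace ℝ (Fin p)) h.real_map_snd_singleton hm hprior ht0 ht1
  rw [Fintype.card_fin, finrank_euclideanSpace_fin] at hle
  exact ((h.hasLaw_labels_whiteNoise hind hD).measureReal_eq
    (measurableSet_lt_norm_gramDefect_isotropicVec _)).trans_le hle

end SampleLaw

section RankPenalty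

variable {m n : Type*} [Fintype n]

lemma rank_sub_le (A B : Matrix m n ℝ) : (A - B).rank ≤ B.rank + A.rank := by
  have hle : LinearMap.range (A - B).mulVecLin ≤
      LinearMap.range B.mulVecLin ⊔ LinearMap.range A.mulVecLin := by
    rintro _ ⟨v, rfl⟩
    rw [Matrix.mulVecLin_apply, Matrix.sub_mulVec]
    exact Submodule.sub_mem _ (Submodule.mem_sup_right ⟨v, rfl⟩)
      (Submodule.mem_sup_left ⟨v, rfl⟩)
  exact (Submodule.finrank_mono hle).trans (Submodule.finrank_add_le_finrank_add_finrank _ _)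

variable [Fintype m]

lemma trace_eq_sum_dotProduct_mulVec (M : Matrix n n ℝ)
    (b : OrthonormalBasis n ℝ (EuclideanSpace ℝ n)) :
    M.trace = ∑ j, (b j).ofLp ⬝ᵥ M.mulVec (b j).ofLp := by
  classical
  simp only [← Matrix.inner_toEuclideanCLM]
  rw [← Matrix.trace_toLin_eq M (EuclideanSpace.basisFun n ℝ).toBasis]
  exact LinearMap.trace_eq_sum_inner _ b

lemma dotProduct_transpose_mul_mulVec (G W : Matrix m n ℝ) (v : n → ℝ) :
    v ⬝ᵥ (G.transpose * W).mulVec v = G.mulVec v ⬝ᵥ W.mulVec v := by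
  rw [← Matrix.mulVec_mulVec, Matrix.dotProduct_mulVec, Matrix.vecMul_transpose]

lemma sq_trace_transpose_mul_le {G W : Matrix m n ℝ} {c : ℝ}
    (h : ∀ v, (G.mulVec v ⬝ᵥ W.mulVec v) ^ 2 ≤ c * (G.mulVec v ⬝ᵥ G.mulVec v) * (v ⬝ᵥ v)) :
    (G.transpose * W).trace ^ 2 ≤ c * G.rank * (G.transpose * G).trace := by
  classical
  have hH : (G.transpose * G).IsHermitian := Matrix.isHermitian_conjTranspose_mul_self G
  set b := hH.eigenvectorBasis
  let a : n → ℝ := fun j => G.mulVec (b j).ofLp ⬝ᵥ W.mulVec (b j).ofLp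
  have hunit : ∀ j, (b j).ofLp ⬝ᵥ (b j).ofLp = 1 := fun j => by
    have hself := real_inner_self_eq_norm_sq (b j)
    rwa [EuclideanSpace.inner_eq_star_dotProduct, star_trivial, b.orthonormal.1 j, one_pow] at hself
  have heig : ∀ j, G.mulVec (b j).ofLp ⬝ᵥ G.mulVec (b j).ofLp = hH.eigenvalues j := fun j => by
    rw [← dotProduct_transpose_mul_mulVec, hH.mulVec_eigenvectorBasis, dotProduct_smul, hunit,
      smul_eq_mul, mul_one]
  have ha : ∀ j, a j ^ 2 ≤ c * hH.eigenvalues j := fun j => by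
    simpa only [hunit, heig, mul_one] using h (b j).ofLp
  have hsupp : ∀ j, hH.eigenvalues j = 0 → a j = 0 := fun j hj =>
    pow_eq_zero_iff two_ne_zero |>.1 <|
      le_antisymm ((ha j).trans_eq (by rw [hj, mul_zero])) (sq_nonneg _)
  have hrank : (G.rank : ℝ) = (Finset.univ.filter fun j => hH.eigenvalues j ≠ 0).card := by
    rw [← Matrix.rank_transpose_mul_self, hH.rank_eq_card_non_zero_eigs, Fintype.card_subtype]
  calc (G.transpose * W).trace ^ 2
      = (∑ j with hH.eigenvalues j ≠ 0, a j) ^ 2 := by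
        rw [trace_eq_sum_dotProduct_mulVec _ b, Finset.sum_filter_of_ne fun j _ => mt (hsupp j)]
        simp only [dotProduct_transpose_mul_mulVec, a]
    _ ≤ G.rank * ∑ j with hH.eigenvalues j ≠ 0, a j ^ 2 := hrank ▸ sq_sum_le_card_mul_sum_sq
    _ ≤ G.rank * ∑ j, c * hH.eigenvalues j := by
        gcongr with j
        refine (Finset.sum_le_sum_of_subset_of_nonneg (Finset.filter_subset _ _)
          fun j _ _ => sq_nonneg (a j)).trans (Finset.sum_le_sum fun j _ => ha j)
    _ = c * G.rank * (G.transpose * G).trace := by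
        rw [hH.trace_eq_sum_eigenvalues, ← Finset.mul_sum]
        simp only [RCLike.ofReal_real_eq_id, id_eq]
        ring

end RankPenalty

section BasicInequality

variable {n p L : ℕ}

lemma frobNorm_sq (Q : Matrix (Fin n) (Fin p) ℝ) :
    frobNorm Q ^ 2 = (Q.transpose * Q).trace := by
  rw [frobNorm, Real.sq_sqrt (by positivity), Finset.sum_comm]
  simp only [Matrix.trace, Matrix.diag, Matrix.mul_apply, Matrix.transpose_apply, sq]

lemma frobNorm_sub_sq (W G : Matrix (Fin n) (Fin p) ℝ) :
    frobNorm (W - G) ^ 2 =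
      frobNorm W ^ 2 - 2 * (G.transpose * W).trace + frobNorm G ^ 2 := by
  have hsymm : (W.transpose * G).trace = (G.transpose * W).trace := by
    rw [← Matrix.trace_transpose, Matrix.transpose_mul, Matrix.transpose_transpose]
  simp only [frobNorm_sq, Matrix.transpose_sub, Matrix.sub_mul, Matrix.mul_sub,
    Matrix.trace_sub, hsymm]
  ring

lemma frobNorm_fit_sq_le {X : Matrix (Fin n) (Fin p) ℝ} {Y : Matrix (Fin n) (Fin L) ℝ}
    {A B : Matrix (Fin p) (Fin L) ℝ} {η κ : ℝ}
    (hmin : frobNorm (Y - X * A) ^ 2 + κ * A.rank ≤ frobNorm (Y - X * B) ^ 2 + κ * B.rank)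
    (hnoise : ∀ e v, (X.mulVec e ⬝ᵥ (Y - X * B).mulVec v) ^ 2 ≤
      η * (X.mulVec e ⬝ᵥ X.mulVec e) * (v ⬝ᵥ v))
    (hη : 0 ≤ η) (hηκ : 2 * η ≤ κ) :
    frobNorm (X * (A - B)) ^ 2 ≤ 4 * (κ * B.rank) := by
  set W := Y - X * B with hW
  set G := X * (A - B) with hG
  have hfit : Y - X * A = W - G := by rw [hW, hG, Matrix.mul_sub]; abel
  rw [hfit, frobNorm_sub_sq] at hmin
  have htrace : (G.transpose * W).trace ^ 2 ≤ η * (B.rank + A.rank) * frobNorm G ^ 2 := by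
    have hG_rank : (G.rank : ℝ) ≤ B.rank + A.rank := by
      exact_mod_cast (Matrix.rank_mul_le_right X (A - B)).trans (rank_sub_le A B)
    refine (sq_trace_transpose_mul_le (c := η) fun v => ?_).trans ?_
    · simpa only [hG, Matrix.mulVec_mulVec] using hnoise ((A - B).mulVec v) v
    · rw [← frobNorm_sq]
      gcongr
  have hcross : 2 * (G.transpose * W).trace ≤
      frobNorm G ^ 2 / 2 + 2 * (η * (B.rank + A.rank)) := by
    refine (abs_le_of_sq_le_sq' ?_ (by positivity)).2
    linarith [sq_nonneg (frobNorm G ^ 2 / 2 - 2 * (η * (B.rank + A.rank)))]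
  have hpenalty : 2 * η * (B.rank + A.rank) ≤ κ * (B.rank + A.rank) := by gcongr
  linarith

lemma rowNorm_le (Q : Matrix (Fin n) (Fin p) ℝ) : rowNorm Q ≤ √n * frobNorm Q := by
  have h := sq_sum_le_card_mul_sum_sq (s := Finset.univ) (f := fun i => √(∑ j, Q i j ^ 2))
  simp only [Finset.card_univ, Fintype.card_fin,
    Real.sq_sqrt (Finset.sum_nonneg fun _ _ => sq_nonneg (Q _ _))] at h
  rw [frobNorm, ← Real.sqrt_mul (Nat.cast_nonneg n)]
  exact Real.le_sqrt_of_sq_le h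

end BasicInequality

section WellConditionedSample

variable {n p L : ℕ} {ν : Measure (Obs p L)} {prior : Fin L → ℝ}
  {μ : Fin L → EuclideanSpace ℝ (Fin p)} {S : Matrix (Fin p) (Fin p) ℝ} {d : Fin n → Obs p L}

lemma featureMatrix_mulVec (d : Fin n → Obs p L) (e : EuclideanSpace ℝ (Fin p)) :
    (featureMatrix d).mulVec e.ofLp = fun i => inner ℝ (d i).1 e := by
  ext i
  simp [featureMatrix, Matrix.mulVec, dotProduct, PiLp.inner_apply, mul_comm]

lemma responseMatrix_mulVec (d : Fin n → Obs p L) (v : Fin L → ℝ) :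
    (responseMatrix d).mulVec v = fun i => v (d i).2 := by
  ext i
  simp [responseMatrix, Matrix.mulVec, dotProduct, oneHot]

lemma featureMatrix_mulVec_eq_inner_whiten (hprior : ∀ ℓ, 0 < prior ℓ) (hS : S.PosDef)
    (d : Fin n → Obs p L) (e : EuclideanSpace ℝ (Fin p)) :
    (featureMatrix d).mulVec e.ofLp =
      fun i => inner ℝ (whiten prior μ S (d i)) (featureMap prior μ S e) := by
  simp only [featureMatrix_mulVec, inner_whiten_featureMap hprior hS]

lemma residual_mulVec_eq_inner_whiten (hprior : ∀ ℓ, 0 < prior ℓ) (hS : S.PosDef)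
    (d : Fin n → Obs p L) (B : Matrix (Fin p) (Fin L) ℝ) (v : EuclideanSpace ℝ (Fin L)) :
    (responseMatrix d - featureMatrix d * B).mulVec v.ofLp =
      fun i => inner ℝ (whiten prior μ S (d i)) (residualVec prior μ S B v) := by
  have hfit := featureMatrix_mulVec_eq_inner_whiten (μ := μ) hprior hS d
    (WithLp.toLp 2 (B.mulVec v.ofLp))
  rw [WithLp.ofLp_toLp] at hfit
  rw [Matrix.sub_mulVec, ← Matrix.mulVec_mulVec, responseMatrix_mulVec, hfit]
  ext i
  rw [Pi.sub_apply, residualVec, inner_sub_right, inner_whiten_labelMap hprior]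

lemma mul_norm_featureMap_sq_le (hprior : ∀ ℓ, 0 < prior ℓ) (hS : S.PosDef) {τ : ℝ}
    (hd : ‖gramDefect fun i => whiten prior μ S (d i)‖ ≤ n * τ) (hτ : τ ≤ 1 / 2)
    (e : EuclideanSpace ℝ (Fin p)) :
    n * ‖featureMap prior μ S e‖ ^ 2 ≤
      2 * ((featureMatrix d).mulVec e.ofLp ⬝ᵥ (featureMatrix d).mulVec e.ofLp) := by
  have hdefect := (abs_le.1 (abs_sum_inner_sq_sub_le hd (featureMap prior μ S e))).1
  have hhalf : n * τ * ‖featureMap prior μ S e‖ ^ 2 ≤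
      n * (1 / 2) * ‖featureMap prior μ S e‖ ^ 2 := by gcongr
  rw [featureMatrix_mulVec_eq_inner_whiten (μ := μ) hprior hS]
  simp only [dotProduct, ← sq]
  linarith

lemma IsLDALaw.dotProduct_residual_sq_le (h : IsLDALaw ν prior μ S) {M τ : ℝ}
    (hM : ∀ ℓ, prior ℓ ≤ M)
    (hd : ‖gramDefect fun i => whiten prior μ S (d i)‖ ≤ n * τ) (hτ : τ ≤ 1 / 2)
    (e : EuclideanSpace ℝ (Fin p)) (v : EuclideanSpace ℝ (Fin L)) :
    ((featureMatrix d).mulVec e.ofLp ⬝ᵥ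
        (responseMatrix d - featureMatrix d * regMatrix ν).mulVec v.ofLp) ^ 2 ≤
      n * (2 * τ ^ 2 * M) * ((featureMatrix d).mulVec e.ofLp ⬝ᵥ (featureMatrix d).mulVec e.ofLp) *
        (v.ofLp ⬝ᵥ v.ofLp) := by
  set ζ := fun i => whiten prior μ S (d i)
  set u := featureMap prior μ S e
  set w := residualVec prior μ S (regMatrix ν) v
  have hcross : (featureMatrix d).mulVec e.ofLp ⬝ᵥ
      (responseMatrix d - featureMatrix d * regMatrix ν).mulVec v.ofLp = gramDefect ζ u w := by
    rw [featureMatrix_mulVec_eq_inner_whiten (μ := μ) h.prior_pos h.posDef,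
      residual_mulVec_eq_inner_whiten (μ := μ) h.prior_pos h.posDef, gramDefect_apply,
      h.inner_featureMap_residual, mul_zero, sub_zero]
    rfl
  have hbound : ‖gramDefect ζ u w‖ ≤ n * τ * ‖u‖ * ‖w‖ :=
    (gramDefect ζ).le_of_opNorm₂_le_of_le hd le_rfl le_rfl
  have hfit := mul_norm_featureMap_sq_le h.prior_pos h.posDef hd hτ e
  have hres := h.norm_residualVec_sq_le hM v
  have hv : v.ofLp ⬝ᵥ v.ofLp = ‖v‖ ^ 2 := by
    rw [EuclideanSpace.real_norm_sq_eq]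
    simp only [dotProduct, sq]
  have hdot : 0 ≤ (featureMatrix d).mulVec e.ofLp ⬝ᵥ (featureMatrix d).mulVec e.ofLp :=
    Finset.sum_nonneg fun _ _ => mul_self_nonneg _
  calc _ = ‖gramDefect ζ u w‖ ^ 2 := by rw [hcross, Real.norm_eq_abs, sq_abs]
    _ ≤ (n * τ * ‖u‖ * ‖w‖) ^ 2 := by gcongr
    _ = n * τ ^ 2 * (n * ‖u‖ ^ 2) * ‖w‖ ^ 2 := by ring
    _ ≤ n * τ ^ 2 * (2 * ((featureMatrix d).mulVec e.ofLp ⬝ᵥ (featureMatrix d).mulVec e.ofLp)) *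
        (M * ‖v‖ ^ 2) := by gcongr
    _ = _ := by rw [hv]; ring

lemma IsLDALaw.frobNorm_fit_sq_le (h : IsLDALaw ν prior μ S) (hn : 0 < n) {M τ lam : ℝ}
    (hM : ∀ ℓ, prior ℓ ≤ M) (hM0 : 0 ≤ M)
    (hd : ‖gramDefect fun i => whiten prior μ S (d i)‖ ≤ n * τ) (hτ : τ ≤ 1 / 2)
    (hlam : 4 * τ ^ 2 * M ≤ lam) {A : Matrix (Fin p) (Fin L) ℝ} (hA : IsRankEstimate lam d A) :
    frobNorm (featureMatrix d * (A - regMatrix ν)) ^ 2 ≤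
      4 * (n * lam * (regMatrix ν).rank) := by
  have hn0 : (0 : ℝ) < n := by exact_mod_cast hn
  refine LDARegression.frobNorm_fit_sq_le (Y := responseMatrix d) (η := n * (2 * τ ^ 2 * M)) ?_
    (fun e v => h.dotProduct_residual_sq_le hM hd hτ (WithLp.toLp 2 e) (WithLp.toLp 2 v))
    (by positivity) ?_
  · have hmin := mul_le_mul_of_nonneg_left (hA (regMatrix ν)) hn0.le
    simpa only [rankCriterion, mul_add, ← mul_assoc, mul_one_div_cancel hn0.ne', one_mul] using hmin
  · calc 2 * (n * (2 * τ ^ 2 * M)) = n * (4 * τ ^ 2 * M) := by ring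
      _ ≤ n * lam := by gcongr

lemma frobNorm_sq_eq_sum_norm_sq (Q : Matrix (Fin n) (Fin p) ℝ) :
    frobNorm Q ^ 2 = ∑ j, ‖WithLp.toLp 2 (Q.col j)‖ ^ 2 := by
  rw [frobNorm, Real.sq_sqrt (by positivity), Finset.sum_comm]
  simp only [EuclideanSpace.real_norm_sq_eq, Matrix.col_apply]

lemma mul_frobNorm_sqrtMat_mul_sq_le (hprior : ∀ ℓ, 0 < prior ℓ) (hS : S.PosDef) {τ : ℝ}
    (hd : ‖gramDefect fun i => whiten prior μ S (d i)‖ ≤ n * τ) (hτ : τ ≤ 1 / 2)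
    (Q : Matrix (Fin p) (Fin L) ℝ) :
    n * frobNorm (sqrtMat S * Q) ^ 2 ≤ 2 * frobNorm (featureMatrix d * Q) ^ 2 := by
  rw [frobNorm_sq_eq_sum_norm_sq, frobNorm_sq_eq_sum_norm_sq, Finset.mul_sum, Finset.mul_sum]
  refine Finset.sum_le_sum fun ℓ _ => ?_
  calc n * ‖sqrtOp S (WithLp.toLp 2 (Q.col ℓ))‖ ^ 2
      ≤ n * ‖featureMap prior μ S (WithLp.toLp 2 (Q.col ℓ))‖ ^ 2 := by
        gcongr
        exact norm_sqrtOp_le_norm_featureMap _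
    _ ≤ _ := mul_norm_featureMap_sq_le hprior hS hd hτ _
    _ = _ := by
        rw [EuclideanSpace.real_norm_sq_eq]
        simp only [dotProduct, sq]
        rfl

end WellConditionedSample

section EigenvalueBound

variable {n p L : ℕ} {c : ℝ} {S : Matrix (Fin p) (Fin p) ℝ}

lemma mul_norm_sq_le_inner_toEuclideanCLM (hS : S.IsHermitian)
    (hc : ∀ j, c ≤ hS.eigenvalues j) (x : EuclideanSpace ℝ (Fin p)) :
    c * ‖x‖ ^ 2 ≤ inner ℝ x (Matrix.toEuclideanCLM (𝕜 := ℝ) S x) := by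
  have hself : IsSelfAdjoint (Matrix.toEuclideanCLM (𝕜 := ℝ) S) := hS.isSelfAdjoint.map _
  have heig : ∀ j, inner ℝ (hS.eigenvectorBasis j) (Matrix.toEuclideanCLM (𝕜 := ℝ) S x) =
      hS.eigenvalues j * inner ℝ (hS.eigenvectorBasis j) x := fun j => by
    have hvec : Matrix.toEuclideanCLM (𝕜 := ℝ) S (hS.eigenvectorBasis j) =
        hS.eigenvalues j • hS.eigenvectorBasis j := by
      ext i
      exact congrFun (hS.mulVec_eigenvectorBasis j) i
    refine (hself.isSymmetric _ _).symm.trans ?_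
    rw [ContinuousLinearMap.coe_coe, hvec, real_inner_smul_left]
  rw [← hS.eigenvectorBasis.sum_inner_mul_inner x, ← hS.eigenvectorBasis.sum_sq_inner_right,
    Finset.mul_sum]
  refine Finset.sum_le_sum fun j _ => ?_
  calc c * inner ℝ (hS.eigenvectorBasis j) x ^ 2
      ≤ hS.eigenvalues j * inner ℝ (hS.eigenvectorBasis j) x ^ 2 := by
        gcongr
        exact hc j
    _ = _ := by rw [heig, real_inner_comm x]; ring

lemma le_opNorm_of_le_eigenvalues (hp : 0 < p) (hS : S.IsHermitian)
    (hc : ∀ j, c ≤ hS.eigenvalues j) : c ≤ opNorm S := by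
  have hx : ‖EuclideanSpace.single (⟨0, hp⟩ : Fin p) (1 : ℝ)‖ = 1 := by simp
  set x := EuclideanSpace.single (⟨0, hp⟩ : Fin p) (1 : ℝ)
  calc c = c * ‖x‖ ^ 2 := by rw [hx, one_pow, mul_one]
    _ ≤ inner ℝ x (Matrix.toEuclideanCLM (𝕜 := ℝ) S x) :=
        mul_norm_sq_le_inner_toEuclideanCLM hS hc x
    _ ≤ ‖x‖ * ‖Matrix.toEuclideanCLM (𝕜 := ℝ) S x‖ := real_inner_le_norm _ _
    _ ≤ ‖x‖ * (opNorm S * ‖x‖) := by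
        gcongr
        exact (Matrix.toEuclideanCLM (𝕜 := ℝ) S).le_opNorm x
    _ = opNorm S := by rw [hx, mul_one, one_mul]

lemma mul_frobNorm_sq_le_frobNorm_sqrtMat_mul_sq (hpos : S.PosSemidef)
    (hc : ∀ j, c ≤ hpos.isHermitian.eigenvalues j) (Q : Matrix (Fin p) (Fin L) ℝ) :
    c * frobNorm Q ^ 2 ≤ frobNorm (sqrtMat S * Q) ^ 2 := by
  rw [frobNorm_sq_eq_sum_norm_sq, frobNorm_sq_eq_sum_norm_sq, Finset.mul_sum]
  refine Finset.sum_le_sum fun ℓ _ => ?_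
  calc c * ‖WithLp.toLp 2 (Q.col ℓ)‖ ^ 2
      ≤ ‖sqrtOp S (WithLp.toLp 2 (Q.col ℓ))‖ ^ 2 := by
        rw [norm_sqrtOp_sq hpos, ← Matrix.inner_toEuclideanCLM]
        exact mul_norm_sq_le_inner_toEuclideanCLM _ hc _
    _ = _ := rfl

lemma errorBounds_of_frobNorm_sq_le (hn : 0 < n) (hc0 : 0 < c) (hpos : S.PosSemidef)
    (hc : ∀ j, c ≤ hpos.isHermitian.eigenvalues j) {d : Fin n → Obs p L}
    {A B : Matrix (Fin p) (Fin L) ℝ} {ω : ℝ} (hω : 0 ≤ ω)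
    (hfit : frobNorm (featureMatrix d * (A - B)) ^ 2 ≤ n * ω ^ 2)
    (hsqrt : frobNorm (sqrtMat S * (A - B)) ^ 2 ≤ ω ^ 2) :
    ErrorBounds d S A B (√p * (ω / √c)) ω := by
  have hn0 : (0 : ℝ) < n := by exact_mod_cast hn
  refine ⟨max_le (abs_le_of_sq_le_sq' ?_ hω).2 (abs_le_of_sq_le_sq' hsqrt hω).2, ?_⟩
  · rwa [div_pow, Real.sq_sqrt hn0.le, div_le_iff₀' hn0]
  · have hfrob : frobNorm (A - B) ≤ ω / √c := by
      refine (abs_le_of_sq_le_sq' ?_ (by positivity)).2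
      rw [div_pow, Real.sq_sqrt hc0.le, le_div_iff₀' hc0]
      exact (mul_frobNorm_sq_le_frobNorm_sqrtMat_mul_sq hpos hc _).trans hsqrt
    exact (rowNorm_le _).trans (by gcongr)

end EigenvalueBound

section GoodSample

variable {n p L : ℕ} {ν : Measure (Obs p L)} {prior : Fin L → ℝ}
  {μ : Fin L → EuclideanSpace ℝ (Fin p)} {S : Matrix (Fin p) (Fin p) ℝ} {d : Fin n → Obs p L}

lemma IsLDALaw.errorBounds_of_norm_gramDefect_le (h : IsLDALaw ν prior μ S) (hn : 0 < n)
    {c M τ lam : ℝ} (hM : ∀ ℓ, prior ℓ ≤ M) (hM0 : 0 ≤ M) (hc0 : 0 < c)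
    (hc : ∀ j, c ≤ h.posDef.isHermitian.eigenvalues j)
    (hd : ‖gramDefect fun i => whiten prior μ S (d i)‖ ≤ n * τ) (hτ : τ ≤ 1 / 2)
    (hlam : 4 * τ ^ 2 * M ≤ lam) {A : Matrix (Fin p) (Fin L) ℝ} (hA : IsRankEstimate lam d A) :
    ErrorBounds d S A (regMatrix ν) (3 / √c * √(lam * (regMatrix ν).rank * p))
      (3 * √(lam * (regMatrix ν).rank)) := by
  have hn0 : (0 : ℝ) < n := by exact_mod_cast hn
  have hlam0 : 0 ≤ lam := le_trans (by positivity) hlam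
  have hfit := h.frobNorm_fit_sq_le hn hM hM0 hd hτ hlam hA
  have hsqrt := mul_frobNorm_sqrtMat_mul_sq_le h.prior_pos h.posDef hd hτ (A - regMatrix ν)
  have hr : 0 ≤ lam * (regMatrix ν).rank := by positivity
  have hω : (3 * √(lam * (regMatrix ν).rank)) ^ 2 = 9 * (lam * (regMatrix ν).rank) := by
    rw [mul_pow, Real.sq_sqrt hr]
    norm_num
  have hω₁ : 3 / √c * √(lam * (regMatrix ν).rank * p) =
      √p * (3 * √(lam * (regMatrix ν).rank) / √c) := by
    rw [Real.sqrt_mul hr]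
    ring
  rw [hω₁]
  refine errorBounds_of_frobNorm_sq_le hn hc0 h.posDef.posSemidef hc (by positivity) ?_ ?_
  · rw [hω]
    nlinarith
  · rw [hω]
    refine le_of_mul_le_mul_left ?_ hn0
    nlinarith

end GoodSample

section FailureProbability

variable {n p L : ℕ}

lemma one_le_log_of_three_le (hn : 3 ≤ n) : 1 ≤ Real.log n := by
  have hn3 : (3 : ℝ) ≤ n := by exact_mod_cast hn
  rw [Real.le_log_iff_exp_le (by positivity)]
  linarith [Real.exp_one_lt_three]

lemma two_mul_exp_neg_le_one_div {y : ℝ} (hn : 2 ≤ n) (hL : L ≤ n) (hy : 3 * Real.log n ≤ y) :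
    L * (2 * Real.exp (-y)) ≤ 1 / n := by
  have hn2 : (2 : ℝ) ≤ n := by exact_mod_cast hn
  have : (0 : ℝ) < n := by linarith
  have hexp : Real.exp (-y) ≤ ((n : ℝ) ^ 3)⁻¹ := by
    rw [Real.exp_neg]
    gcongr
    rwa [← Real.log_le_iff_le_exp (by positivity), Real.log_pow]
  calc (L : ℝ) * (2 * Real.exp (-y)) ≤ n * (n * ((n : ℝ) ^ 3)⁻¹) := by gcongr
    _ = 1 / n := by field_simp

lemma four_mul_pow_mul_exp_neg_le_one_div {q : ℕ} {y : ℝ} (hn : 0 < n)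
    (hy : 2 + 4 * q + Real.log n ≤ y) : 4 * 25 ^ q * Real.exp (-y) ≤ 1 / n := by
  have hn0 : (0 : ℝ) < n := by exact_mod_cast hn
  have hexp : ∀ k : ℕ, (2.7 : ℝ) ^ k ≤ Real.exp k := fun k => by
    rw [← mul_one (k : ℝ), Real.exp_nat_mul]
    gcongr
    linarith [Real.exp_one_gt_d9]
  have h4 : (4 : ℝ) ≤ Real.exp 2 := le_trans (by norm_num) (hexp 2)
  have h25 : (25 : ℝ) ≤ Real.exp 4 := le_trans (by norm_num) (hexp 4)
  calc 4 * 25 ^ q * Real.exp (-y) ≤ Real.exp 2 * Real.exp 4 ^ q * Real.exp (-y) := by gcongr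
    _ = Real.exp (2 + 4 * q - y) := by
        rw [← Real.exp_nat_mul, ← Real.exp_add, ← Real.exp_add]
        ring_nf
    _ ≤ Real.exp (-Real.log n) := Real.exp_le_exp.2 (by linarith)
    _ = 1 / n := by rw [Real.exp_neg, Real.exp_log hn0, one_div]

lemma failure_probability_le {a k t : ℝ} (hn : 3 ≤ n) (hL : 0 < L) (hk : 1024 ≤ k)
    (hak : 12 ≤ a * k) (ht : n * t ^ 2 = k * ((p + L) * Real.log n))
    (hsize : (p + L) * Real.log n ≤ n) :
    L * (2 * Real.exp (-(n * (a / L) * t ^ 2 / 4))) +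
      4 * 25 ^ (L + p) * Real.exp (-(n * t ^ 2 / 128)) ≤ 2 / n := by
  have hlog := one_le_log_of_three_le hn
  have hL1 : (1 : ℝ) ≤ L := by exact_mod_cast hL
  have : (0 : ℝ) ≤ p := p.cast_nonneg
  have hLn : (L : ℝ) ≤ n := by nlinarith
  have hlabel : 3 * Real.log n ≤ n * (a / L) * t ^ 2 / 4 := by
    have hratio : Real.log n ≤ (p + L) * Real.log n / L := by
      rw [le_div_iff₀ (by positivity)]
      nlinarith
    calc 3 * Real.log n ≤ a * k * ((p + L) * Real.log n / L) / 4 := by nlinarith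
      _ = a / L * (n * t ^ 2) / 4 := by rw [ht]; ring
      _ = _ := by ring
  have hgauss : 2 + 4 * ((L + p : ℕ) : ℝ) + Real.log n ≤ n * t ^ 2 / 128 := by
    have hx : (p : ℝ) + L ≤ (p + L) * Real.log n := by nlinarith
    have hlogx : Real.log n ≤ (p + L) * Real.log n := by nlinarith
    have hkx : 1024 * ((p + L) * Real.log n) ≤ k * ((p + L) * Real.log n) := by gcongr
    rw [ht]
    push_cast
    linarith
  calc _ ≤ 1 / (n : ℝ) + 1 / n := add_le_add
        (two_mul_exp_neg_le_one_div (by lia) (by exact_mod_cast hLn) hlabel)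
        (four_mul_pow_mul_exp_neg_le_one_div (by lia) hgauss)
    _ = 2 / n := by ring

end FailureProbability

section HighProbability

lemma exists_measurableSet_of_measureReal_le {Ω : Type*} [MeasurableSpace Ω] {P : Measure Ω}
    [IsProbabilityMeasure P] {bad : Set Ω} {δ : ℝ} (hbad : P.real bad ≤ δ) {q : Ω → Prop}
    (hq : ∀ᵐ ω ∂P, q ω) :
    ∃ E : Set Ω, MeasurableSet E ∧ 1 - δ ≤ P.real E ∧ ∀ ω ∈ E, ω ∉ bad ∧ q ω := by
  set N := bad ∪ {ω | ¬q ω}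
  have hN : P.real N ≤ δ := by
    refine (measureReal_union_le _ _).trans ?_
    rwa [measureReal_def P {ω | ¬q ω}, ae_iff.1 hq, ENNReal.toReal_zero, add_zero]
  refine ⟨(toMeasurable P N)ᶜ, (measurableSet_toMeasurable P N).compl, ?_, fun ω hω => ?_⟩
  · rw [probReal_compl_eq_one_sub (measurableSet_toMeasurable P N), measureReal_def,
      measure_toMeasurable]
    exact sub_le_sub_left hN 1
  · have hωN : ω ∉ N := fun h => hω (subset_toMeasurable P N h)
    simpa only [N, Set.mem_union, Set.mem_ofPred_eq, not_or, not_not] using hωN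

variable {n p L : ℕ} {ν : Measure (Obs p L)} {prior : Fin L → ℝ}
  {μ : Fin L → EuclideanSpace ℝ (Fin p)} {S : Matrix (Fin p) (Fin p) ℝ}

lemma IsLDALaw.card_labels_pos (h : IsLDALaw ν prior μ S) : 0 < L := by
  have := h.isProbabilityMeasure
  exact (nonempty_of_isProbabilityMeasure ν).some.2.pos

lemma IsLDALaw.exists_event_errorBounds (h : IsLDALaw ν prior μ S) (hn : 3 ≤ n)
    {cπ Cπ cW k lam : ℝ} (hcW : 0 < cW) (hbal : BalancedPriors cπ Cπ prior)
    (hwithin : ∀ j, cW ≤ h.posDef.isHermitian.eigenvalues j)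
    (hk : 1024 ≤ k) (hck : 12 ≤ cπ * k) (hcπ : 0 < cπ)
    (hsize : 1024 * k * ((p + L) * Real.log n) ≤ n)
    (hlam : 1024 * k * Cπ * ((p + L) * Real.log n / (n * L)) ≤ lam)
    {Ω : Type*} [MeasurableSpace Ω] {P : Measure Ω} [IsProbabilityMeasure P]
    {D : Fin n → Ω → Obs p L} (hind : iIndepFun D P) (hD : ∀ i, HasLaw (D i) ν P)
    {Bhat : Ω → Matrix (Fin p) (Fin L) ℝ}
    (hB : ∀ᵐ ω ∂P, IsRankEstimate lam (fun i => D i ω) (Bhat ω)) :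
    ∃ E : Set Ω, MeasurableSet E ∧ 1 - 2 / (n : ℝ) ≤ P.real E ∧
      ∀ ω ∈ E, ErrorBounds (fun i => D i ω) S (Bhat ω) (regMatrix ν)
        (3 / √cW * √(lam * (regMatrix ν).rank * p)) (3 * √(lam * (regMatrix ν).rank)) := by
  have hL := h.card_labels_pos
  have : (0 : ℝ) < L := by exact_mod_cast hL
  have hn0 : (0 : ℝ) < n := by
    have : 0 < n := by lia
    exact_mod_cast this
  have hx0 : 0 ≤ (p + L) * Real.log n := by positivity
  set t := √(k * ((p + L) * Real.log n) / n)
  have htsq : t ^ 2 = k * ((p + L) * Real.log n) / n := Real.sq_sqrt (by positivity)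
  have hnt : n * t ^ 2 = k * ((p + L) * Real.log n) := by rw [htsq]; field_simp
  have ht0 : 0 ≤ t := Real.sqrt_nonneg _
  have ht32 : 32 * t ≤ 1 := by
    refine (abs_le_of_sq_le_sq' ?_ zero_le_one).2
    rw [mul_pow, htsq, mul_div_assoc', one_pow, div_le_one hn0]
    linarith
  have hx : (p + L) * Real.log n ≤ n := by nlinarith
  have hprob := (h.measureReal_lt_norm_gramDefect_whiten_le hind hD (by positivity)
    (fun ℓ => (hbal ℓ).1) ht0 (by linarith)).trans
    (failure_probability_le hn hL hk hck hnt hx)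
  obtain ⟨E, hE, hPE, hgood⟩ := exists_measurableSet_of_measureReal_le hprob hB
  refine ⟨E, hE, hPE, fun ω hω => ?_⟩
  obtain ⟨hdefect, hmin⟩ := hgood ω hω
  have hM0 : 0 ≤ Cπ / L := (h.prior_pos ⟨0, hL⟩).le.trans (hbal _).2
  refine h.errorBounds_of_norm_gramDefect_le (by lia) (τ := 16 * t) (fun ℓ => (hbal ℓ).2) hM0 hcW
    hwithin ((not_lt.1 hdefect).trans_eq (by ring)) (by linarith) ?_ hmin
  refine le_trans (le_of_eq ?_) hlam
  rw [mul_pow, htsq]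
  ring

lemma errorBounds_of_isEmpty {L : ℕ} (d : Fin n → Obs 0 L) (S : Matrix (Fin 0) (Fin 0) ℝ)
    (A B : Matrix (Fin 0) (Fin L) ℝ) {ω₁ ω₂ : ℝ} (h₁ : 0 ≤ ω₁) (h₂ : 0 ≤ ω₂) :
    ErrorBounds d S A B ω₁ ω₂ := by
  have hzero : A - B = 0 := Subsingleton.elim _ _
  simp [ErrorBounds, hzero, frobNorm, rowNorm, h₁, h₂]

lemma one_sub_two_div_nonpos (hn : 0 < n) (hn2 : n ≤ 2) : 1 - 2 / (n : ℝ) ≤ 0 := by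
  have hn0 : (0 : ℝ) < n := by exact_mod_cast hn
  rw [sub_nonpos, one_le_div hn0]
  exact_mod_cast hn2

end HighProbability

section PenaltyLevel

lemma mul_le_div_sqrt_mul_sqrt_mul_sqrt {a b c m k : ℝ} (ha0 : 0 ≤ a) (ha1 : a ≤ 1) (hc : 0 < c)
    (hcm : c ≤ m) (hb : 0 ≤ b) (hk : 0 ≤ k) : k * a ≤ k / √c * √(m * (1 + b)) * √a := by
  have hsqrt : √c ≤ √(m * (1 + b)) := Real.sqrt_le_sqrt (by nlinarith)
  calc k * a = k / √c * √c * a := by rw [div_mul_cancel₀ _ (Real.sqrt_pos.2 hc).ne']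
    _ ≤ k / √c * √(m * (1 + b)) * √a := by
        gcongr
        exact Real.le_sqrt_of_sq_le (by nlinarith)

lemma mul_rate_le_mul_sqrt_rate {n p L : ℕ} (hp : 0 < p) (hL : 0 < L)
    {c k Δ : ℝ} (hc : 0 < c) (hk : 0 ≤ k) (hΔ : 0 ≤ Δ) {S : Matrix (Fin p) (Fin p) ℝ}
    (hS : S.IsHermitian) (heig : ∀ j, c ≤ hS.eigenvalues j)
    (hsize : (p + L) * Real.log n ≤ n) :
    k * ((p + L) * Real.log n / (n * L)) ≤
      k / √c * √(opNorm S * (1 + Δ)) * √((p + L) * Real.log n / (n * L)) := by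
  have hL1 : (1 : ℝ) ≤ L := by exact_mod_cast hL
  have hrate : (p + L) * Real.log n / (n * L) ≤ 1 :=
    div_le_one_of_le₀ (hsize.trans (le_mul_of_one_le_right (by positivity) hL1)) (by positivity)
  exact mul_le_div_sqrt_mul_sqrt_mul_sqrt (by positivity) hrate hc
    (le_opNorm_of_le_eigenvalues hp hS heig) hΔ hk

end PenaltyLevel

end LDARegression

theorem theorem8_general (cπ Cπ cW : ℝ) (hcπ : 0 < cπ) (hcW : 0 < cW) :
    ∃ c > 0, ∃ C > 0, ∃ K₁ > 0, ∃ K₂ > 0,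
      ∀ (n p L : ℕ), 1 ≤ n →
      ∀ (ν : Measure (LDARegression.Obs p L)) (prior : Fin L → ℝ)
        (μ : Fin L → EuclideanSpace ℝ (Fin p)) (S : Matrix (Fin p) (Fin p) ℝ),
        LDARegression.IsLDALaw ν prior μ S →
        LDARegression.BalancedPriors cπ Cπ prior →
        (∃ hS : S.IsHermitian, ∀ j, cW ≤ hS.eigenvalues j) →
        ((p : ℝ) + L) * Real.log n ≤ c * n →
      ∀ lam : ℝ, (0 < p → C * (((p : ℝ) + L) * Real.log n / ((n : ℝ) * L)) ≤ lam) →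
      ∀ (Ω : Type*) [MeasurableSpace Ω] (P : Measure Ω) [IsProbabilityMeasure P]
        (D : Fin n → Ω → LDARegression.Obs p L),
        iIndepFun D P → (∀ i, HasLaw (D i) ν P) →
      ∀ Bhat : Ω → Matrix (Fin p) (Fin L) ℝ,
        (∀ᵐ ω ∂P, LDARegression.IsRankEstimate lam (fun i => D i ω) (Bhat ω)) →
        ∃ E : Set Ω, MeasurableSet E ∧ 1 - 2 / (n : ℝ) ≤ P.real E ∧
          ∀ ω ∈ E, LDARegression.ErrorBounds (fun i => D i ω) S (Bhat ω)
            (LDARegression.regMatrix ν)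
            (K₁ * √(lam * ((LDARegression.regMatrix ν).rank : ℝ) * p))
            (K₂ * √(lam * ((LDARegression.regMatrix ν).rank : ℝ))) := by
  obtain ⟨k, hk, hck⟩ : ∃ k : ℝ, 1024 ≤ k ∧ 12 ≤ cπ * k :=
    ⟨1024 + 12 / cπ, le_add_of_nonneg_right (by positivity), by
      rw [mul_add, mul_div_cancel₀ _ hcπ.ne']; linarith⟩
  have : 0 < k := by linarith
  refine ⟨1 / (1024 * k), by positivity, 1024 * k * (|Cπ| + 1), by positivity, 3 / √cW,
    by positivity, 3, by norm_num, ?_⟩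
  intro n p L hn ν prior μ S hlaw hbal ⟨_, heig⟩ hsize lam hlam Ω _ P _ D hind hD Bhat hB
  rcases p.eq_zero_or_pos with rfl | hp
  · exact ⟨Set.univ, MeasurableSet.univ, by simp [div_nonneg], fun ω _ =>
      LDARegression.errorBounds_of_isEmpty _ _ _ _ (by positivity) (by positivity)⟩
  rcases Nat.lt_or_ge n 3 with hn3 | hn3
  · exact ⟨∅, MeasurableSet.empty, by
      simpa using LDARegression.one_sub_two_div_nonpos hn (by lia), fun ω hω => hω.elim⟩
  · refine hlaw.exists_event_errorBounds hn3 hcW hbal heig hk hck hcπ ?_ ?_ hind hD hB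
    · rwa [← le_div_iff₀' (by positivity), ← one_div_mul_eq_div]
    · refine le_trans ?_ (hlam hp)
      gcongr
      linarith [le_abs_self Cπ]

theorem theorem8 (cπ Cπ cΔ CΔ cW CW : ℝ) (hcπ : 0 < cπ) (hcΔ : 0 < cΔ) (hcW : 0 < cW) :
    ∃ c > 0, ∃ C > 0, ∃ K₁ > 0, ∃ K₂ > 0,
      ∀ (n p L : ℕ), 1 ≤ n → 2 ≤ L →
      ∀ (ν : Measure (LDARegression.Obs p L)) (prior : Fin L → ℝ)
        (μ : Fin L → EuclideanSpace ℝ (Fin p)) (S : Matrix (Fin p) (Fin p) ℝ) (Δ : ℝ),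
        LDARegression.IsLDALaw ν prior μ S →
        LDARegression.BalancedPriors cπ Cπ prior →
        0 < Δ → LDARegression.SeparatedMeans cΔ CΔ Δ μ S →
        LDARegression.BoundedWithinCov cW CW S →
        ((p : ℝ) + L) * Real.log n ≤ c * n →
      ∀ lam : ℝ, 0 < lam →
        C * √(LDARegression.opNorm S * (1 + Δ)) *
          √(((p : ℝ) + L) * Real.log n / ((n : ℝ) * L)) ≤ lam →
      ∀ (Ω : Type*) [MeasurableSpace Ω] (P : Measure Ω) [IsProbabilityMeasure P]
        (D : Fin n → Ω → LDARegression.Obs p L),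
        iIndepFun D P → (∀ i, HasLaw (D i) ν P) →
      ∀ Bhat : Ω → Matrix (Fin p) (Fin L) ℝ,
        (∀ᵐ ω ∂P, LDARegression.IsRankEstimate lam (fun i => D i ω) (Bhat ω)) →
        ∃ E : Set Ω, MeasurableSet E ∧ 1 - 2 / (n : ℝ) ≤ P.real E ∧
          ∀ ω ∈ E, LDARegression.ErrorBounds (fun i => D i ω) S (Bhat ω)
            (LDARegression.regMatrix ν)
            (K₁ * √(lam * ((LDARegression.regMatrix ν).rank : ℝ) * p))
            (K₂ * √(lam * ((LDARegression.regMatrix ν).rank : ℝ))) := by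
  obtain ⟨c, hc, C, hC, K₁, hK₁, K₂, hK₂, h⟩ := theorem8_general cπ Cπ cW hcπ hcW
  refine ⟨min c 1, lt_min hc one_pos, C / √cW, by positivity, K₁, hK₁, K₂, hK₂, ?_⟩
  intro n p L hn hL ν prior μ S Δ hlaw hbal hΔ _ ⟨⟨hS, heig⟩, _⟩ hsize lam _ hlam
  exact h n p L hn ν prior μ S hlaw hbal ⟨hS, fun j => (heig j).le⟩
    (hsize.trans (by gcongr; exact min_le_left c 1)) lam fun hp =>
    (LDARegression.mul_rate_le_mul_sqrt_rate hp (by lia) hcW hC.le hΔ.le hS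
      (fun j => (heig j).le)
      (hsize.trans (mul_le_of_le_one_left n.cast_nonneg (min_le_right c 1)))).trans hlam
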